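/- Let $G$ be a finite group and let $X$ be a finite set with a structure of $G$-family of biquandles, that is, operations $\underline{\triangleright}^g,\overline{\triangleright}^g:X\times X\to X$ $(g\in G)$ such that for all $g,h\in G$ and $a,b,c\in X$: (i) $a\,\underline{\triangleright}^g a=a\,\overline{\triangleright}^g a$; (ii) the maps $x\mapsto x\,\underline{\triangleright}^g a$, $x\mapsto x\,\overline{\triangleright}^g a$ and $(x,y)\mapsto(y\,\overline{\triangleright}^g x,\ x\,\underline{\triangleright}^h y)$ are bijections; (iii) $(a\,\underline{\triangleright}^g b)\underline{\triangleright}^h(c\,\overline{\triangleright}^g b)=(a\,\underline{\triangleright}^h c)\underline{\triangleright}^{h^{-1}gh}(b\,\underline{\triangleright}^h c)$, $(a\,\overline{\triangleright}^g b)\underline{\triangleright}^h(c\,\overline{\triangleright}^g b)=(a\,\underline{\triangleright}^h c)\overline{\triangleright}^{h^{-1}gh}(b\,\underline{\triangleright}^h c)$ and $(a\,\overline{\triangleright}^g b)\overline{\triangleright}^h(c\,\overline{\triangleright}^g b)=(a\,\overline{\triangleright}^h c)\overline{\triangleright}^{h^{-1}gh}(b\,\underline{\triangleright}^h c)$; (iv)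 $a\,\underline{\triangleright}^{gh}b=(a\,\underline{\triangleright}^g b)\underline{\triangleright}^h(b\,\underline{\triangleright}^g b)$ and $a\,\overline{\triangleright}^{gh}b=(a\,\overline{\triangleright}^g b)\overline{\triangleright}^h(b\,\overline{\triangleright}^g b)$. On $Q=X\times G$ put $(a,g)\,\underline{\triangleright}\,(b,h)=(a\,\underline{\triangleright}^h b,\,h^{-1}gh)$, $(a,g)\,\overline{\triangleright}\,(b,h)=(a\,\overline{\triangleright}^h b,\,g)$, and define the partial product $(a,g)\cdot(a\,\underline{\triangleright}^g a,h)=(a,gh)$. Let $\Gamma$ be a $Y$-oriented spatial trivalent graph diagram: a diagram of a directed spatial trivalent graph (circle components allowed) none of whose vertices is a source or a sink. An $X$-coloring of $\Gamma$ assigns an element of $Q$ to each semiarc (portion of the diagram between consecutive under-crossing points, over-crossing points and vertices) so that the following holds. At a crossing, let $p$ be the color of the under-semiarc to the right of the over-strand and $q$ the color of the over-semiarc to the right of the under-strand; then the other under-semiarc has color $p\,\underline{\triangleright}\,q$ and the other over-semiarc has color $q\,\overline{\triangleright}\,p$. At a vertex where two edges $e_r$ (right) and $e_l$ (left, seen in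 the direction of the flow) merge into $e$, or where $e$ splits into $e_r$ and $e_l$, the product of the colors of $e_r$ and $e_l$, in this order, is defined and equals the color of $e$. Let $\pi_1(S^3\setminus\Gamma)$ be given by the Wirtinger presentation of the diagram, with one generator (meridian) for each semiarc. For $\psi\in\mathrm{Hom}(\pi_1(S^3\setminus\Gamma),G)$ let $\pi^{-1}(\psi)$ be the set of $X$-colorings of $\Gamma$ whose $G$-component on each semiarc is the value of $\psi$ on its meridian, and set $$\Phi_X^G(\Gamma)=\sum_{\psi\in\mathrm{Hom}(\pi_1(S^3\setminus\Gamma),G)}u^{|\pi^{-1}(\psi)|}\in\mathbb{Z}[u].$$ If two $Y$-oriented spatial trivalent graph diagrams $\Gamma$ and $\Gamma'$ are related by a finite sequence of $Y$-oriented Reidemeister moves for handlebody-knots (the moves I-V for spatial trivalent graphs and the IH-move VI, with all $Y$-orientations), then $\Phi_X^G(\Gamma)=\Phi_X^G(\Gamma')$. Hence $\Phi_X^G$ is a well-defined invariant of $S^1$-oriented handlebody-knots and handlebody-links, understood as equivalence classes of $Y$-oriented diagrams under these moves. -/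

import Mathlib

open Polynomial

/-- A `G`-family of biquandles on `X`: `uop g a b` and `oop g a b` are `a` operated on by `b`
through the underlined, respectively the overlined, triangle of exponent `g`. -/
structure BiquandleFamily (G : Type*) [Group G] (X : Type*) where
  uop : G → X → X → X
  oop : G → X → X → X
  under_self : ∀ g a, uop g a a = oop g a a
  under_bijective : ∀ g a, Function.Bijective fun x => uop g x a
  over_bijective : ∀ g a, Function.Bijective fun x => oop g x a
  sideways_bijective : ∀ g h,
    Function.Bijective fun p : X × X => (oop g p.2 p.1, uop h p.1 p.2)
  exchange_under_under : ∀ g h a b c,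
    uop h (uop g a b) (oop g c b) = uop (h⁻¹ * g * h) (uop h a c) (uop h b c)
  exchange_over_under : ∀ g h a b c,
    uop h (oop g a b) (oop g c b) = oop (h⁻¹ * g * h) (uop h a c) (uop h b c)
  exchange_over_over : ∀ g h a b c,
    oop h (oop g a b) (oop g c b) = oop (h⁻¹ * g * h) (oop h a c) (uop h b c)
  under_mul : ∀ g h a b, uop (g * h) a b = uop h (uop g a b) (uop g b b)
  over_mul : ∀ g h a b, oop (g * h) a b = oop h (oop g a b) (oop g b b)

namespace BiquandleFamily

variable {G : Type*} [Group G] {X : Type*} (F : BiquandleFamily G X)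

/-! The partially multiplicative biquandle `Q = X × G` associated with a `G`-family. -/

/-- `(a, g) ▷ (b, h) = (a ▷^h b, h⁻¹ g h)` (underlined operation of `Q`). -/
def qUnder (p q : X × G) : X × G := (F.uop q.2 p.1 q.1, q.2⁻¹ * p.2 * q.2)

/-- `(a, g) ▷ (b, h) = (a ▷^h b, g)` (overlined operation of `Q`). -/
def qOver (p q : X × G) : X × G := (F.oop q.2 p.1 q.1, p.2)

/-- The graph of the partial multiplication of `Q`: the product `p q` is defined exactly for
`p = (a, g)`, `q = (a ▷^g a, h)`, and is then `(a, g h)`. -/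
def IsQMul (p q r : X × G) : Prop :=
  q.1 = F.uop p.2 p.1 p.1 ∧ r = (p.1, p.2 * q.2)

end BiquandleFamily

/-- The nodes of a `Y`-oriented spatial trivalent graph diagram, with their incident oriented
semiarcs.
* `crossing s ui uo oi oo`: a crossing, positive iff `s = true`; the under-strand enters along `ui`
  and leaves along `uo`, the over-strand enters along `oi` and leaves along `oo`.
* `merge r l o`: a vertex with two incoming edges `r`, `l` and one outgoing edge `o`; an observer
  looking in the direction of the flow has `r` on the right and `l` on the left.
* `split i r l`: a vertex with one incoming edge `i` and two outgoing edges, `r` on the right and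
  `l` on the left.
A vertex that is a source or a sink is not allowed. -/
inductive Node (E : Type*) where
  | crossing (s : Bool) (ui uo oi oo : E)
  | merge (r l o : E)
  | split (i r l : E)

namespace Node

variable {E E' : Type*}

/-- Relabelling of semiarcs. -/
def map (f : E → E') : Node E → Node E'
  | crossing s ui uo oi oo => crossing s (f ui) (f uo) (f oi) (f oo)
  | merge r l o => merge (f r) (f l) (f o)
  | split i r l => split (f i) (f r) (f l)

/-- The ends of semiarcs at a node, in counterclockwise cyclic order. The pair `(e, true)` is the
initial end of `e` (`e` leaves the node), `(e, false)` is its terminal end (`e` enters the node). -/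
def ends : Node E → List (E × Bool)
  | crossing true ui uo oi oo => [(oo, true), (uo, true), (oi, false), (ui, false)]
  | crossing false ui uo oi oo => [(oo, true), (ui, false), (oi, false), (uo, true)]
  | merge r l o => [(o, true), (l, false), (r, false)]
  | split i r l => [(i, false), (r, true), (l, true)]

/-- The colouring condition at a node, for colours in `Q = X × G`. At a crossing let `u`, `o` be the
under-semiarc to the right of the over-strand and the over-semiarc to the right of the
under-strand; the opposite semiarcs then carry the underlined `u ▷ o` and the overlined `o ▷ u`.
At a vertex the colour of the single edge is the product of the right one and the left one. -/
def IsColored {G : Type*} [Group G] {X : Type*} (F : BiquandleFamily G X) (c : E → X × G) :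
    Node E → Prop
  | crossing true ui uo oi oo =>
      c uo = F.qUnder (c ui) (c oo) ∧ c oi = F.qOver (c oo) (c ui)
  | crossing false ui uo oi oo =>
      c ui = F.qUnder (c uo) (c oi) ∧ c oo = F.qOver (c oi) (c uo)
  | merge r l o => F.IsQMul (c r) (c l) (c o)
  | split i r l => F.IsQMul (c r) (c l) (c i)

/-- The Wirtinger relators at a node. The generator of a semiarc is the loop from a base point above
the plane that passes below the semiarc from its right side to its left side. -/
def relators : Node E → List (FreeGroup E)
  | crossing true ui uo oi oo =>
      [.of oi * (.of oo)⁻¹, .of uo * ((.of oo)⁻¹ * .of ui * .of oo)⁻¹]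
  | crossing false ui uo oi oo =>
      [.of oo * (.of oi)⁻¹, .of ui * ((.of oi)⁻¹ * .of uo * .of oi)⁻¹]
  | merge r l o => [.of o * (.of r * .of l)⁻¹]
  | split i r l => [.of i * (.of r * .of l)⁻¹]

end Node

/-! ### Planarity

A list of nodes defines a combinatorial map: the edge ends with their counterclockwise order at each
node. It is drawn on a disjoint union of closed oriented surfaces, one for each connected component;
these are all spheres iff `V - E + F = 2 K`. -/

section Planarity

variable {E : Type*}

/-- The edge ends that occur in a list of nodes. -/
abbrev EndOf (N : List (Node E)) : Type _ := {d : E × Bool // ∃ n ∈ N, d ∈ n.ends}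

/-- `d'` follows `d` counterclockwise around a node. -/
def NextEnd (N : List (Node E)) (d d' : E × Bool) : Prop :=
  ∃ n ∈ N, (d, d') ∈ n.ends.zip (n.ends.rotate 1)

/-- One step along the boundary of a face: run along the edge from the end `d` to its other end, then
take the counterclockwise next end at the node reached. -/
def FaceStep (N : List (Node E)) (d d' : EndOf N) : Prop :=
  NextEnd N (d.1.1, !d.1.2) d'.1

/-- Two ends belong to the same edge or to the same node. -/
def Linked (N : List (Node E)) (d d' : EndOf N) : Prop :=
  d.1.1 = d'.1.1 ∨ ∃ n ∈ N, d.1 ∈ n.ends ∧ d'.1 ∈ n.ends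

/-- Twice the Euler formula: all components of the combinatorial map have genus `0`. The number of
edges is half the number of edge ends. -/
def IsPlanar (N : List (Node E)) : Prop :=
  2 * N.length + 2 * Nat.card (Quot (FaceStep N)) =
    Nat.card (EndOf N) + 4 * Nat.card (Quot (Linked N))

end Planarity

/-- A diagram of a `Y`-oriented spatial trivalent graph (with finitely many components, and up to
isotopy of the sphere): a finite set `E` of oriented semiarcs and a finite list of crossings and
vertices. Each semiarc either has one initial and one terminal end at the nodes, or is a closed
circle without any node on it. -/
structure Diagram where
  E : Type
  finite : Finite E
  nodes : List (Node E)
  nodup : (nodes.flatMap Node.ends).Nodup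
  initial_iff_terminal : ∀ e,
    (e, true) ∈ nodes.flatMap Node.ends ↔ (e, false) ∈ nodes.flatMap Node.ends
  planar : IsPlanar nodes

attribute [instance] Diagram.finite

/-! ### Fragments of diagrams and the Reidemeister moves -/

/-- A fragment of a diagram whose semiarcs may have been cut at finitely many points: a list of nodes,
and a list of strands `(a, b)` without nodes, entered along `a` and left along `b`. Fragments are
joined to each other wherever a piece leaving one of them has the same label as a piece entering
another. -/
structure Fragment where
  strands : List (ℕ × ℕ)
  nodes : List (Node ℕ)

namespace Fragment

/-- Relabelling of the pieces. -/
def map (f : ℕ → ℕ) (P : Fragment) : Fragment :=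
  ⟨P.strands.map (Prod.map f f), P.nodes.map (Node.map f)⟩

/-- Juxtaposition of fragments. -/
def append (P O : Fragment) : Fragment := ⟨P.strands ++ O.strands, P.nodes ++ O.nodes⟩

/-- All ends of pieces. -/
def ends (P : Fragment) : List (ℕ × Bool) :=
  P.strands.flatMap (fun s => [(s.1, false), (s.2, true)]) ++ P.nodes.flatMap Node.ends

/-- The labels of the pieces. -/
def labels (P : Fragment) : Set ℕ := {a | ∃ b, (a, b) ∈ P.ends}

/-- Every piece has exactly one initial and one terminal end: nothing is left open. -/
def IsClosed (P : Fragment) : Prop :=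
  P.ends.Nodup ∧ ∀ a, (a, true) ∈ P.ends ↔ (a, false) ∈ P.ends

/-- The closed fragment `P` is the diagram `D`, up to the names of the semiarcs, the order of the
nodes and the cutting of semiarcs into pieces: `s` sends each piece to the semiarc that contains it,
and two pieces lie on the same semiarc iff they are joined through strands. -/
def Represents (P : Fragment) (D : Diagram) : Prop :=
  P.IsClosed ∧ ∃ s : ℕ → D.E,
    (∀ e, ∃ a ∈ P.labels, s a = e) ∧
    (∀ a ∈ P.labels, ∀ b ∈ P.labels,
      s a = s b ↔ Relation.EqvGen (fun x y => (x, y) ∈ P.strands) a b) ∧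
    (P.nodes.map (Node.map s)).Perm D.nodes

end Fragment

namespace Move

/-- A pair of pieces, in the order in which a strand runs through them: `(x, y)` if `d`, else
`(y, x)`. -/
def directed (d : Bool) (x y : ℕ) : ℕ × ℕ := if d then (x, y) else (y, x)

/-- A crossing at which the strand `p.1 → p.2` crosses the strand `q.1 → q.2`, over it if `above`,
under it otherwise. The direction of `q` is to the left of the direction of `p` iff `left`. -/
def cross (above left : Bool) (p q : ℕ × ℕ) : Node ℕ :=
  if above then .crossing left q.1 q.2 p.1 p.2 else .crossing (!left) p.1 p.2 q.1 q.2

/-- A choice of directions of the three legs of a vertex (`true` for outgoing) for which the vertex is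
neither a source nor a sink. -/
def IsY (d₀ d₁ d₂ : Bool) : Prop := ¬ (d₀ = d₁ ∧ d₁ = d₂)

/-- The vertex with legs `x₀, x₁, x₂` in counterclockwise order, where `xᵢ` is outgoing iff `dᵢ`.
Only used for `IsY d₀ d₁ d₂`. -/
def vertex (d₀ d₁ d₂ : Bool) (x₀ x₁ x₂ : ℕ) : Node ℕ :=
  match d₀, d₁, d₂ with
  | true, false, false => .merge x₂ x₁ x₀
  | false, true, false => .merge x₀ x₂ x₁
  | false, false, _ => .merge x₁ x₀ x₂
  | false, true, true => .split x₀ x₁ x₂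
  | true, false, true => .split x₁ x₂ x₀
  | true, true, _ => .split x₂ x₀ x₁

/-- The first or the second step of a strand `x → y → z`. -/
def step (first : Bool) (x y z : ℕ) : ℕ × ℕ := if first then (x, y) else (y, z)

/-- The plain strand `0 → 1`. -/
def r1Left : Fragment := ⟨[(0, 1)], []⟩

/-- The strand `0 → 2 → 1` with one kink, of either sign, passing first under or first over. -/
def r1Right (sign underFirst : Bool) : Fragment :=
  if underFirst then ⟨[], [.crossing sign 0 2 2 1]⟩ else ⟨[], [.crossing sign 2 1 0 2]⟩

/-- Two plain strands `0 → 1` and `2 → 3`. -/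
def r2Left : Fragment := ⟨[(0, 1), (2, 3)], []⟩

/-- The strand `0 → 4 → 1` lies over the strand `2 → 5 → 3`, which it crosses twice; the two strands
run in the same direction iff `parallel`. -/
def r2Right (sign parallel : Bool) : Fragment :=
  if parallel then ⟨[], [.crossing sign 2 5 0 4, .crossing (!sign) 5 3 4 1]⟩
  else ⟨[], [.crossing sign 5 3 0 4, .crossing (!sign) 2 5 4 1]⟩

/-- Three strands, top `0 → 1 → 2`, middle `3 → 4 → 5`, bottom `6 → 7 → 8`, that form a triangle. The
signs of the crossings top/middle, top/bottom, middle/bottom are `x`, `y`, `z`. The two values of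
`side` are the two positions of a strand with respect to the crossing of the other two. -/
def r3 (x y z side : Bool) : Fragment :=
  -- on the top strand, the middle one comes before the bottom one
  let t := (x == y) == side
  -- on the middle strand, the top one comes before the bottom one
  let m := (x == z) == side
  -- on the bottom strand, the top one comes before the middle one
  let b := (y == z) == side
  ⟨[], [cross true x (step t 0 1 2) (step m 3 4 5),
        cross true y (step (!t) 0 1 2) (step b 6 7 8),
        cross true z (step (!m) 3 4 5) (step (!b) 6 7 8)]⟩

/-! In the next moves a vertex has three legs, to the south (outer piece `0`), the north-east (`1`) and
the north-west (`2`), with directions `dᵢ` (`true` if the leg is outgoing). -/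

/-- A strand with ends `3` (west) and `4` (east), running east iff `east`, passes over or under the
southern leg. -/
def r4Left (above east d₀ d₁ d₂ : Bool) : Fragment :=
  ⟨[], [vertex d₀ d₁ d₂ 5 1 2,
        cross above (east != d₀) (directed east 3 4) (directed d₀ 5 0)]⟩

/-- The same strand passes over or under the two northern legs. -/
def r4Right (above east d₀ d₁ d₂ : Bool) : Fragment :=
  ⟨[], [vertex d₀ d₁ d₂ 0 6 7,
        cross above (east == d₂) (directed east 3 8) (directed d₂ 7 2),
        cross above (east == d₁) (directed east 8 4) (directed d₁ 6 1)]⟩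

/-- A vertex. -/
def r5Left (d₀ d₁ d₂ : Bool) : Fragment := ⟨[], [vertex d₀ d₁ d₂ 0 1 2]⟩

/-- The two northern legs cross each other: the inner piece `3` leaves the vertex to the north-east and
continues to the north-western end `2`, the inner piece `4` leaves it to the north-west and continues
to the north-eastern end `1`. -/
def r5Right (above d₀ d₁ d₂ : Bool) : Fragment :=
  ⟨[], [vertex d₀ d₂ d₁ 0 3 4,
        cross above (d₁ != d₂) (directed d₂ 3 2) (directed d₁ 4 1)]⟩

/-! In the last move there are four legs, to the north-east (`0`), the north-west (`1`), the south-west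
(`2`) and the south-east (`3`), with directions `dᵢ` (`true` if outgoing), and an inner edge `4`. -/

/-- The inner edge is vertical, directed to the south iff `m`. -/
def r6Left (m d₀ d₁ d₂ d₃ : Bool) : Fragment :=
  ⟨[], [vertex d₀ d₁ m 0 1 4, vertex d₂ d₃ (!m) 2 3 4]⟩

/-- The inner edge is horizontal, directed to the east iff `m`. -/
def r6Right (m d₀ d₁ d₂ d₃ : Bool) : Fragment :=
  ⟨[], [vertex m d₁ d₂ 4 1 2, vertex d₀ (!m) d₃ 0 4 3]⟩

/-- The pairs of local pictures of the Reidemeister moves I - VI for handlebody-knots, with all their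
`Y`-orientations. Pieces with equal labels on the boundary of the two pictures correspond. -/
inductive Local : Fragment → Fragment → Prop
  | r1 (sign underFirst : Bool) : Local r1Left (r1Right sign underFirst)
  | r2 (sign parallel : Bool) : Local r2Left (r2Right sign parallel)
  | r3 (x y z : Bool) : Local (r3 x y z true) (r3 x y z false)
  | r4 (above east d₀ d₁ d₂ : Bool) (h : IsY d₀ d₁ d₂) :
      Local (r4Left above east d₀ d₁ d₂) (r4Right above east d₀ d₁ d₂)
  | r5 (above d₀ d₁ d₂ : Bool) (h : IsY d₀ d₁ d₂) :
      Local (r5Left d₀ d₁ d₂) (r5Right above d₀ d₁ d₂)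
  | r6 (m m' d₀ d₁ d₂ d₃ : Bool) (hn : IsY d₀ d₁ m) (hs : IsY d₂ d₃ (!m))
      (hw : IsY m' d₁ d₂) (he : IsY d₀ (!m') d₃) :
      Local (r6Left m d₀ d₁ d₂ d₃) (r6Right m' d₀ d₁ d₂ d₃)

end Move

namespace Diagram

/-- Two diagrams are the same up to the names of their semiarcs and the order of their nodes. -/
def Isotopic (D D' : Diagram) : Prop :=
  ∃ P : Fragment, P.Represents D ∧ P.Represents D'

/-- `D'` arises from `D` by one Reidemeister move: `D` and `D'` consist of the two pictures of a move
and of one and the same fragment `O` outside. -/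
def ReidemeisterMove (D D' : Diagram) : Prop :=
  ∃ (P P' O : Fragment) (f : ℕ → ℕ), Move.Local P P' ∧
    ((P.map f).append O).Represents D ∧ ((P'.map f).append O).Represents D'

/-- The equivalence of diagrams generated by the Reidemeister moves. -/
def relatedSetoid : Setoid Diagram :=
  Relation.EqvGen.setoid fun D D' => Isotopic D D' ∨ ReidemeisterMove D D'

/-- `D` and `D'` are related by a finite sequence of Reidemeister moves and their inverses. -/
def Related (D D' : Diagram) : Prop := relatedSetoid D D'

/-- The fundamental group of the complement of the spatial graph, by its Wirtinger presentation: one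
generator for each semiarc, and the relations at the crossings and vertices. -/
abbrev FundamentalGroup (D : Diagram) : Type :=
  PresentedGroup {w : FreeGroup D.E | ∃ n ∈ D.nodes, w ∈ n.relators}

/-- The meridian of a semiarc. -/
def meridian (D : Diagram) (e : D.E) : D.FundamentalGroup := PresentedGroup.of e

instance (D : Diagram) {G : Type*} [Group G] [Finite G] : Finite (D.FundamentalGroup →* G) :=
  Finite.of_injective (fun (ψ : D.FundamentalGroup →* G) (e : D.E) => ψ (D.meridian e)) fun _ _ h =>
    PresentedGroup.ext fun e => congrFun h e

/-- An `X`-colouring of the diagram: colours in `Q = X × G` on the semiarcs such that the condition at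
every crossing and every vertex holds. -/
def IsColoring {G : Type*} [Group G] {X : Type*} (F : BiquandleFamily G X) (D : Diagram)
    (c : D.E → X × G) : Prop := ∀ n ∈ D.nodes, n.IsColored F c

/-- The set of `X`-colourings that project to the `G`-colouring `ψ`. -/
def fiber {G : Type*} [Group G] {X : Type*} (F : BiquandleFamily G X) (D : Diagram)
    (ψ : D.FundamentalGroup →* G) : Set (D.E → X × G) :=
  {c | D.IsColoring F c ∧ ∀ e, (c e).2 = ψ (D.meridian e)}

open Classical in
/-- The `G`-enhanced biquandle counting polynomial: the sum of `u ^ |π⁻¹(ψ)|` over all homomorphisms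
`ψ` from the fundamental group of the complement to `G`. -/
noncomputable def enhancedPolynomial {G : Type*} [Group G] [Finite G] {X : Type*} [Finite X]
    (F : BiquandleFamily G X) (D : Diagram) : ℤ[X] :=
  letI := Fintype.ofFinite (D.FundamentalGroup →* G)
  ∑ ψ : D.FundamentalGroup →* G, (Polynomial.X : ℤ[X]) ^ (D.fiber F ψ).ncard

end Diagram

/-- An `S¹`-oriented handlebody-knot (or handlebody-link), as an equivalence class of `Y`-oriented
diagrams under the Reidemeister moves. -/
def HandlebodyKnot : Type 1 := Quotient Diagram.relatedSetoid

/-- The handlebody-knot represented by a diagram. -/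
def Diagram.handlebodyKnot (D : Diagram) : HandlebodyKnot := Quotient.mk _ D

/-!
The partial product makes `Q` a groupoid on the object set `X`, in which `(a, g)` is an arrow from
`a` to `a ▷^g a` (underlined operation). If the colour of a semiarc is replaced by its inverse when
the direction of the semiarc is reversed, the conditions at crossings and vertices do not depend on
directions. Up to such reversals, move III is the exchange law, move IV is the exchange law together
with axiom (iv), and the IH-move is associativity in the groupoid. So the two pictures of a move
admit the same colours on their boundary, and these determine the colours inside.

The homomorphisms from the fundamental group to `G` are the colourings by the one-point family.
Applying the correspondence of colourings both to this family and to the given one yields a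
bijection of homomorphisms together with bijections of the fibres over corresponding homomorphisms.
-/

namespace BiquandleFamily

variable {G : Type*} [Group G] {X : Type*} {F : BiquandleFamily G X}

lemma eq_of_uop_eq_oop {g : G} {a b : X} (h : F.uop g a b = F.oop g b a) : a = b := by
  have h_over : F.oop g b a = F.oop g b b := by
    refine (F.over_bijective g (F.oop g b a)).1 ?_
    simpa [h] using F.exchange_over_over g g b a b
  exact congrArg Prod.fst ((F.sideways_bijective g g).1 (a₁ := (a, b)) (a₂ := (b, b))
    (Prod.ext h_over (h.trans (h_over.trans (F.under_self g b).symm))))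

lemma bijective_uop_self (g : G) : Function.Bijective fun a => F.uop g a a := by
  constructor
  · intro a b h
    have h_over : F.oop g a a = F.oop g b b := by simpa only [← F.under_self] using h
    exact congrArg Prod.fst ((F.sideways_bijective g g).1 (a₁ := (a, a)) (a₂ := (b, b))
      (Prod.ext h_over h))
  · intro b
    obtain ⟨⟨x, y⟩, hxy⟩ := (F.sideways_bijective g g).2 (b, b)
    obtain ⟨hy, hx⟩ := Prod.mk.inj hxy
    obtain rfl : x = y := eq_of_uop_eq_oop (hx.trans hy.symm)
    exact ⟨x, hx⟩

@[simp] lemma uop_one (a b : X) : F.uop 1 a b = a := by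
  obtain ⟨c, rfl⟩ := (bijective_uop_self (F := F) 1).2 b
  obtain ⟨a, rfl⟩ := (F.under_bijective 1 c).2 a
  simpa using (F.under_mul 1 1 a c).symm

@[simp] lemma oop_one (a b : X) : F.oop 1 a b = a := by
  obtain ⟨c, rfl⟩ := (bijective_uop_self (F := F) 1).2 b
  obtain ⟨a, rfl⟩ := (F.over_bijective 1 c).2 a
  simpa [F.under_self] using (F.over_mul 1 1 a c).symm

lemma uop_inv_uop (g : G) (a b : X) : F.uop g⁻¹ (F.uop g a b) (F.uop g b b) = a := by
  rw [← F.under_mul, mul_inv_cancel, uop_one]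

lemma oop_inv_oop (g : G) (a b : X) : F.oop g⁻¹ (F.oop g a b) (F.uop g b b) = a := by
  rw [F.under_self, ← F.over_mul, mul_inv_cancel, oop_one]

/-! ### The biquandle `Q` -/

lemma bijective_qUnder (q : X × G) : Function.Bijective fun p => F.qUnder p q := by
  have h := (F.under_bijective q.2 q.1).prodMap (MulAut.conj q.2⁻¹).bijective
  simpa only [Prod.map_def, MulAut.conj_apply, inv_inv, qUnder] using h

lemma bijective_qOver (q : X × G) : Function.Bijective fun p => F.qOver p q :=
  (F.over_bijective q.2 q.1).prodMap Function.bijective_id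

lemma bijective_qSideways :
    Function.Bijective fun p : (X × G) × (X × G) => (F.qOver p.2 p.1, F.qUnder p.1 p.2) := by
  constructor
  · rintro ⟨⟨a, g⟩, b, h⟩ ⟨⟨a', g'⟩, b', h'⟩ e
    simp only [qOver, qUnder, Prod.mk.injEq] at e
    obtain ⟨⟨h_over, rfl⟩, h_under, h_conj⟩ := e
    obtain rfl : g = g' := by simpa using h_conj
    have h_eq := (F.sideways_bijective g h).1 (a₁ := (a, b)) (a₂ := (a', b'))
      (Prod.ext h_over h_under)
    simp_all
  · rintro ⟨⟨b, h⟩, a, g⟩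
    obtain ⟨⟨x, y⟩, hxy⟩ := (F.sideways_bijective (h * g * h⁻¹) h).2 (b, a)
    obtain ⟨hy, hx⟩ := Prod.mk.inj hxy
    exact ⟨((x, h * g * h⁻¹), y, h), by simp_all [qOver, qUnder, ← mul_assoc]⟩

lemma qUnder_self (p : X × G) : F.qUnder p p = F.qOver p p := by
  simp [qUnder, qOver, F.under_self]

lemma bijective_qUnder_self : Function.Bijective fun p => F.qUnder p p := by
  have h_eq : (fun p => F.qUnder p p) = fun p => (F.uop p.2 p.1 p.1, p.2) := by
    ext p <;> simp [qUnder]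
  rw [h_eq]
  constructor
  · rintro ⟨a, g⟩ ⟨b, h⟩ e
    obtain ⟨e, rfl⟩ := Prod.mk.inj e
    exact Prod.ext ((bijective_uop_self g).1 e) rfl
  · rintro ⟨b, g⟩
    obtain ⟨a, rfl⟩ := (bijective_uop_self (F := F) g).2 b
    exact ⟨(a, g), rfl⟩

lemma qExchange_under_under (a b c : X × G) :
    F.qUnder (F.qUnder a b) (F.qOver c b) = F.qUnder (F.qUnder a c) (F.qUnder b c) := by
  simp [qUnder, qOver, F.exchange_under_under, mul_assoc]

lemma qExchange_over_under (a b c : X × G) :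
    F.qUnder (F.qOver a b) (F.qOver c b) = F.qOver (F.qUnder a c) (F.qUnder b c) := by
  simp [qUnder, qOver, F.exchange_over_under]

lemma qExchange_over_over (a b c : X × G) :
    F.qOver (F.qOver a b) (F.qOver c b) = F.qOver (F.qOver a c) (F.qUnder b c) := by
  simp [qUnder, qOver, F.exchange_over_over]

/-! ### Inverse colours -/

variable (F) in
/-- The inverse of `p` in `Q`, which is a groupoid under its partial multiplication: `(a, g)` is a
morphism from `a` to `a ▷^g a`. It is the colour that `p` becomes when its semiarc is reversed. -/
def qInv (p : X × G) : X × G := (F.uop p.2 p.1 p.1, p.2⁻¹)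

@[simp] lemma qInv_qInv (p : X × G) : F.qInv (F.qInv p) = p :=
  Prod.ext (uop_inv_uop p.2 p.1 p.1) (inv_inv p.2)

lemma surjective_qInv : Function.Surjective F.qInv :=
  Function.LeftInverse.surjective qInv_qInv

lemma qUnder_qInv_right (p q : X × G) : F.qUnder (F.qUnder p q) (F.qInv q) = p :=
  Prod.ext (uop_inv_uop q.2 p.1 q.1) (by simp [qUnder, qInv, mul_assoc])

lemma qOver_qInv_right (p q : X × G) : F.qOver (F.qOver p q) (F.qInv q) = p :=
  Prod.ext (oop_inv_oop q.2 p.1 q.1) rfl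

lemma qInv_qOver (p q : X × G) : F.qInv (F.qOver p q) = F.qOver (F.qInv p) (F.qUnder q p) :=
  Prod.ext (F.exchange_over_under q.2 p.2 p.1 q.1 p.1) rfl

lemma qInv_qUnder (p q : X × G) : F.qInv (F.qUnder p q) = F.qUnder (F.qInv p) (F.qOver q p) :=
  Prod.ext (F.exchange_under_under p.2 q.2 p.1 p.1 q.1).symm
    (by simp [qUnder, qOver, qInv, mul_assoc])

namespace IsQMul

variable {p q r : X × G}

lemma rotate (h : F.IsQMul p q r) : F.IsQMul q (F.qInv r) (F.qInv p) := by
  obtain ⟨a, g⟩ := p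
  obtain ⟨b, h⟩ := q
  obtain ⟨rfl, rfl⟩ := h
  simp [IsQMul, qInv, F.under_mul]

lemma unique {r' : X × G} (h : F.IsQMul p q r) (h' : F.IsQMul p q r') : r = r' :=
  h.2.trans h'.2.symm

end IsQMul

lemma isQMul_qInv_right {p q r : X × G} : F.IsQMul r (F.qInv q) p ↔ F.IsQMul p q r := by
  have h_imp {p q r : X × G} (h : F.IsQMul p q r) : F.IsQMul r (F.qInv q) p := by
    obtain ⟨hq, rfl⟩ := h
    exact ⟨by simp only [qInv, hq, F.under_mul], by simp [qInv]⟩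
  exact ⟨fun h => by simpa using h_imp h, h_imp⟩

lemma IsQMul.assoc {p₁ p₂ p₃ p₂₃ p : X × G} (h : F.IsQMul p₂ p₃ p₂₃) (h' : F.IsQMul p₁ p₂₃ p) :
    ∃ p₁₂, F.IsQMul p₁ p₂ p₁₂ ∧ F.IsQMul p₁₂ p₃ p := by
  obtain ⟨h₃, rfl⟩ := h
  obtain ⟨h₂, rfl⟩ := h'
  exact ⟨_, ⟨h₂, rfl⟩, by rw [h₃, h₂, F.under_mul], by simp [mul_assoc]⟩

variable (F) in
/-- The colour `p`, read along its semiarc if `d` and against it otherwise. -/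
def orient (d : Bool) (p : X × G) : X × G := if d then p else F.qInv p

@[simp] lemma orient_true (p : X × G) : F.orient true p = p := rfl

@[simp] lemma orient_false (p : X × G) : F.orient false p = F.qInv p := rfl

@[simp] lemma orient_orient (d : Bool) (p : X × G) : F.orient d (F.orient d p) = p := by
  cases d <;> simp

@[simp] lemma orient_not (d : Bool) (p : X × G) : F.orient (!d) p = F.qInv (F.orient d p) := by
  cases d <;> simp

lemma orient_injective (d : Bool) : Function.Injective (F.orient d) :=
  Function.LeftInverse.injective (orient_orient d)

/-! ### Colours at a vertex -/

variable (F) in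
/-- The three colours have an identity as their product in the groupoid `Q`. This is the colouring
condition for three edges `p, q, r` in counterclockwise order, all directed away from a vertex. -/
def IsTriangle (p q r : X × G) : Prop := F.IsQMul p q (F.qInv r)

namespace IsTriangle

variable {p q r : X × G}

lemma rotate (h : F.IsTriangle p q r) : F.IsTriangle q r p := by
  simpa [IsTriangle] using IsQMul.rotate h

lemma unique {r' : X × G} (h : F.IsTriangle p q r) (h' : F.IsTriangle p q r') : r = r' := by
  simpa using congrArg F.qInv (IsQMul.unique h h')

end IsTriangle

lemma isTriangle_rotate {p q r : X × G} : F.IsTriangle q r p ↔ F.IsTriangle p q r :=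
  ⟨fun h => h.rotate.rotate, IsTriangle.rotate⟩

lemma isTriangle_iff_isQMul {p q r : X × G} : F.IsTriangle r p q ↔ F.IsQMul p q (F.qInv r) :=
  isTriangle_rotate.symm

lemma isTriangle_qInv {p q r : X × G} :
    F.IsTriangle r (F.qInv q) (F.qInv p) ↔ F.IsQMul p q r := by
  rw [IsTriangle, qInv_qInv, isQMul_qInv_right]

lemma IsTriangle.flip {p q r s : X × G} :
    (∃ x, F.IsTriangle p q x ∧ F.IsTriangle r s (F.qInv x)) →
      ∃ x, F.IsTriangle q r x ∧ F.IsTriangle s p (F.qInv x) := by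
  rintro ⟨x, h, h'⟩
  obtain ⟨y, hy, hy'⟩ := IsQMul.assoc (p₂ := r) (p₃ := s) (by simpa [IsTriangle] using h') h.rotate
  exact ⟨F.qInv y, by simpa [IsTriangle] using hy, by simpa [IsTriangle] using hy'.rotate⟩

lemma exists_isTriangle_flip {p q r s : X × G} :
    (∃ x, F.IsTriangle p q x ∧ F.IsTriangle r s (F.qInv x)) ↔
      ∃ x, F.IsTriangle q r x ∧ F.IsTriangle s p (F.qInv x) := by
  refine ⟨IsTriangle.flip, fun h => ?_⟩
  obtain ⟨x, h₁, h₂⟩ := IsTriangle.flip h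
  exact ⟨F.qInv x, h₂, by simpa using h₁⟩

/-! ### Colours at a crossing -/

variable (F) in
/-- The colouring condition at a crossing, where the under-strand has the colours `a₀` and `a₁` to
the right and to the left of the over-strand, and the over-strand has the colours `b₀` and `b₁` to
the right and to the left of the under-strand. -/
def Crossed (a₀ a₁ b₀ b₁ : X × G) : Prop := a₁ = F.qUnder a₀ b₀ ∧ b₁ = F.qOver b₀ a₀

namespace Crossed

variable {a₀ a₁ b₀ b₁ a₀' a₁' b₀' b₁' : X × G}

lemma exists₀₀ (a₀ b₀ : X × G) : ∃ a₁ b₁, F.Crossed a₀ a₁ b₀ b₁ := ⟨_, _, rfl, rfl⟩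

lemma exists₀₁ (a₀ b₁ : X × G) : ∃ a₁ b₀, F.Crossed a₀ a₁ b₀ b₁ := by
  obtain ⟨b₀, rfl⟩ := (bijective_qOver (F := F) a₀).2 b₁
  exact ⟨_, b₀, rfl, rfl⟩

lemma exists₁₀ (a₁ b₀ : X × G) : ∃ a₀ b₁, F.Crossed a₀ a₁ b₀ b₁ := by
  obtain ⟨a₀, rfl⟩ := (bijective_qUnder (F := F) b₀).2 a₁
  exact ⟨a₀, _, rfl, rfl⟩

lemma exists₁₁ (a₁ b₁ : X × G) : ∃ a₀ b₀, F.Crossed a₀ a₁ b₀ b₁ := by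
  obtain ⟨⟨a₀, b₀⟩, h⟩ := (bijective_qSideways (F := F)).2 (b₁, a₁)
  obtain ⟨rfl, rfl⟩ := Prod.mk.inj h
  exact ⟨a₀, b₀, rfl, rfl⟩

lemma unique₀₀ (h : F.Crossed a₀ a₁ b₀ b₁) (h' : F.Crossed a₀ a₁' b₀ b₁') :
    a₁ = a₁' ∧ b₁ = b₁' :=
  ⟨h.1.trans h'.1.symm, h.2.trans h'.2.symm⟩

lemma unique₀₁ (h : F.Crossed a₀ a₁ b₀ b₁) (h' : F.Crossed a₀ a₁' b₀' b₁) :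
    a₁ = a₁' ∧ b₀ = b₀' := by
  obtain rfl : b₀ = b₀' := (bijective_qOver a₀).1 (h.2.symm.trans h'.2)
  exact ⟨(h.unique₀₀ h').1, rfl⟩

lemma unique₁₀ (h : F.Crossed a₀ a₁ b₀ b₁) (h' : F.Crossed a₀' a₁ b₀ b₁') :
    a₀ = a₀' ∧ b₁ = b₁' := by
  obtain rfl : a₀ = a₀' := (bijective_qUnder b₀).1 (h.1.symm.trans h'.1)
  exact ⟨rfl, (h.unique₀₀ h').2⟩

lemma unique₁₁ (h : F.Crossed a₀ a₁ b₀ b₁) (h' : F.Crossed a₀' a₁ b₀' b₁) :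
    a₀ = a₀' ∧ b₀ = b₀' :=
  Prod.mk.inj ((bijective_qSideways (F := F)).1 (a₁ := (a₀, b₀)) (a₂ := (a₀', b₀'))
    (Prod.ext (h.2.symm.trans h'.2) (h.1.symm.trans h'.1)))

lemma exists_self₀ (a : X × G) : ∃ b, F.Crossed a b a b := ⟨_, rfl, qUnder_self a⟩

lemma exists_self₁ (b : X × G) : ∃ a, F.Crossed a b a b := by
  obtain ⟨a, rfl⟩ := (bijective_qUnder_self (F := F)).2 b
  exact ⟨a, rfl, qUnder_self a⟩

lemma eq_iff (h : F.Crossed a₀ a₁ b₀ b₁) : a₀ = b₀ ↔ a₁ = b₁ := by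
  constructor
  · rintro rfl
    rw [h.1, h.2, qUnder_self]
  · rintro rfl
    obtain ⟨a, ha⟩ := exists_self₁ (F := F) a₁
    obtain ⟨rfl, rfl⟩ := h.unique₁₁ ha
    rfl

lemma exists_kink₁ : (∃ x, F.Crossed a₀ x b₀ x) ↔ a₀ = b₀ :=
  ⟨fun ⟨_, h⟩ => h.eq_iff.2 rfl, fun h => h ▸ exists_self₀ a₀⟩

lemma exists_kink₀ : (∃ x, F.Crossed x a₁ x b₁) ↔ a₁ = b₁ :=
  ⟨fun ⟨_, h⟩ => h.eq_iff.1 rfl, fun h => h ▸ exists_self₁ a₁⟩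

end Crossed

lemma crossed_qInv_over {a₀ a₁ b₀ b₁ : X × G} :
    F.Crossed a₁ a₀ (F.qInv b₀) (F.qInv b₁) ↔ F.Crossed a₀ a₁ b₀ b₁ := by
  have h_imp {a₀ a₁ b₀ b₁ : X × G} (h : F.Crossed a₀ a₁ b₀ b₁) :
      F.Crossed a₁ a₀ (F.qInv b₀) (F.qInv b₁) := by
    obtain ⟨rfl, rfl⟩ := h
    exact ⟨(qUnder_qInv_right a₀ b₀).symm, qInv_qOver b₀ a₀⟩
  exact ⟨fun h => by simpa using h_imp h, h_imp⟩

lemma crossed_qInv_under {a₀ a₁ b₀ b₁ : X × G} :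
    F.Crossed (F.qInv a₀) (F.qInv a₁) b₁ b₀ ↔ F.Crossed a₀ a₁ b₀ b₁ := by
  have h_imp {a₀ a₁ b₀ b₁ : X × G} (h : F.Crossed a₀ a₁ b₀ b₁) :
      F.Crossed (F.qInv a₀) (F.qInv a₁) b₁ b₀ := by
    obtain ⟨rfl, rfl⟩ := h
    exact ⟨qInv_qUnder a₀ b₀, (qOver_qInv_right b₀ a₀).symm⟩
  exact ⟨fun h => by simpa using h_imp h, h_imp⟩

/-! ### The third Reidemeister move

The colours of a bottom strand `a`, a middle strand `b` and a top strand `c` form the edges of a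
cube, and the crossings its faces. The index of an edge tells which of the two other strands, in
alphabetical order, it lies to the left of: none (`0`), the first (`1`), the second (`2`) or both
(`3`). The two pictures of the move consist of the faces at two opposite corners, which are denoted
by their coordinates. -/

section Cube

variable {a₀ a₁ a₂ a₃ b₀ b₁ b₂ b₃ c₀ c₁ c₂ c₃ : X × G}

lemma exists_cube (a₀ b₀ c₀ : X × G) : ∃ a₁ a₂ a₃ b₁ b₂ b₃ c₁ c₂ c₃,
    (F.Crossed a₀ a₁ b₀ b₁ ∧ F.Crossed a₀ a₂ c₀ c₁ ∧ F.Crossed b₀ b₂ c₀ c₂) ∧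
    (F.Crossed a₂ a₃ b₂ b₃ ∧ F.Crossed a₁ a₃ c₂ c₃ ∧ F.Crossed b₁ b₃ c₁ c₃) :=
  ⟨_, _, _, _, _, _, _, _, _, ⟨⟨rfl, rfl⟩, ⟨rfl, rfl⟩, ⟨rfl, rfl⟩⟩, ⟨rfl, rfl⟩,
    ⟨(qExchange_under_under a₀ b₀ c₀).symm, rfl⟩, (qExchange_over_under b₀ a₀ c₀).symm,
    (qExchange_over_over c₀ a₀ b₀).symm⟩

lemma exists_corner_010_iff_corner_101 :
    (∃ a₁ b₀ c₂, F.Crossed b₀ b₂ c₀ c₂ ∧ F.Crossed a₁ a₃ c₂ c₃ ∧ F.Crossed a₀ a₁ b₀ b₁) ↔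
      ∃ a₂ b₃ c₁, F.Crossed b₁ b₃ c₁ c₃ ∧ F.Crossed a₀ a₂ c₀ c₁ ∧ F.Crossed a₂ a₃ b₂ b₃ := by
  constructor
  · rintro ⟨a₁, b₀, c₂, h_bc, h_ac, h_ab⟩
    obtain ⟨_, a₂, _, _, _, b₃, c₁, _, _, ⟨k_ab, k_ac, k_bc⟩, l_ab, l_ac, l_bc⟩ :=
      exists_cube (F := F) a₀ b₀ c₀
    obtain ⟨rfl, rfl⟩ := h_ab.unique₀₀ k_ab
    obtain ⟨rfl, rfl⟩ := h_bc.unique₀₀ k_bc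
    obtain ⟨rfl, rfl⟩ := h_ac.unique₀₀ l_ac
    exact ⟨a₂, b₃, c₁, l_bc, k_ac, l_ab⟩
  · rintro ⟨a₂, b₃, c₁, h_bc, h_ac, h_ab⟩
    obtain ⟨_, b₀, h_b₀⟩ := Crossed.exists₀₁ (F := F) a₀ b₁
    obtain ⟨a₁, _, _, _, _, _, _, c₂, _, ⟨k_ab, k_ac, k_bc⟩, l_ab, l_ac, l_bc⟩ :=
      exists_cube (F := F) a₀ b₀ c₀
    obtain ⟨rfl, rfl⟩ := h_b₀.unique₀₀ k_ab
    obtain ⟨rfl, rfl⟩ := h_ac.unique₀₀ k_ac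
    obtain ⟨rfl, rfl⟩ := h_bc.unique₀₀ l_bc
    obtain ⟨rfl, rfl⟩ := h_ab.unique₀₁ l_ab
    exact ⟨_, b₀, c₂, k_bc, l_ac, k_ab⟩

lemma exists_corner_100_iff_corner_011 :
    (∃ a₀ b₁ c₁, F.Crossed b₁ b₃ c₁ c₃ ∧ F.Crossed a₀ a₂ c₀ c₁ ∧ F.Crossed a₀ a₁ b₀ b₁) ↔
      ∃ a₃ b₂ c₂, F.Crossed b₀ b₂ c₀ c₂ ∧ F.Crossed a₁ a₃ c₂ c₃ ∧ F.Crossed a₂ a₃ b₂ b₃ := by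
  constructor
  · rintro ⟨a₀, b₁, c₁, h_bc, h_ac, h_ab⟩
    obtain ⟨_, _, a₃, _, b₂, _, _, c₂, _, ⟨k_ab, k_ac, k_bc⟩, l_ab, l_ac, l_bc⟩ :=
      exists_cube (F := F) a₀ b₀ c₀
    obtain ⟨rfl, rfl⟩ := h_ab.unique₀₀ k_ab
    obtain ⟨rfl, rfl⟩ := h_ac.unique₀₀ k_ac
    obtain ⟨rfl, rfl⟩ := h_bc.unique₀₀ l_bc
    exact ⟨a₃, b₂, c₂, k_bc, l_ac, l_ab⟩
  · rintro ⟨a₃, b₂, c₂, h_bc, h_ac, h_ab⟩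
    obtain ⟨a₀, _, h_a₀⟩ := Crossed.exists₁₀ (F := F) a₁ b₀
    obtain ⟨_, _, _, b₁, _, _, c₁, _, _, ⟨k_ab, k_ac, k_bc⟩, l_ab, l_ac, l_bc⟩ :=
      exists_cube (F := F) a₀ b₀ c₀
    obtain ⟨rfl, rfl⟩ := h_a₀.unique₀₀ k_ab
    obtain ⟨rfl, rfl⟩ := h_bc.unique₀₀ k_bc
    obtain ⟨rfl, rfl⟩ := h_ac.unique₀₀ l_ac
    obtain ⟨rfl, rfl⟩ := h_ab.unique₁₀ l_ab
    exact ⟨a₀, _, _, l_bc, k_ac, k_ab⟩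

end Cube

/-! ### A strand passing a vertex -/

section Slide

variable {p q r s : X × G}

lemma IsQMul.qUnder_qUnder (h : F.IsQMul p q r) :
    F.qUnder (F.qUnder s p) q = F.qUnder s r := by
  obtain ⟨hq, rfl⟩ := h
  exact Prod.ext (by simp only [qUnder, hq, F.under_mul]) (by simp [qUnder, mul_assoc])

lemma IsQMul.qOver_qOver (h : F.IsQMul p q r) : F.qOver (F.qOver s p) q = F.qOver s r := by
  obtain ⟨hq, rfl⟩ := h
  exact Prod.ext (by simp only [qOver, hq, F.over_mul, F.under_self]) rfl

lemma isQMul_qUnder_iff :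
    F.IsQMul (F.qUnder p s) (F.qUnder q (F.qOver s p)) (F.qUnder r s) ↔ F.IsQMul p q r := by
  have h_fst : (F.qUnder q (F.qOver s p)).1 = F.uop (F.qUnder p s).2 (F.qUnder p s).1
      (F.qUnder p s).1 ↔ q.1 = F.uop p.2 p.1 p.1 := by
    simp only [qUnder, qOver, ← F.exchange_under_under]
    exact (F.under_bijective _ _).1.eq_iff
  rw [IsQMul, h_fst, IsQMul, ← (bijective_qUnder (F := F) s).1.eq_iff (a := r)]
  simp [qUnder, qOver, mul_assoc]

lemma isQMul_qOver_iff :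
    F.IsQMul (F.qOver p s) (F.qOver q (F.qUnder s p)) (F.qOver r s) ↔ F.IsQMul p q r := by
  have h_fst : (F.qOver q (F.qUnder s p)).1 = F.uop (F.qOver p s).2 (F.qOver p s).1
      (F.qOver p s).1 ↔ q.1 = F.uop p.2 p.1 p.1 := by
    simp only [qUnder, qOver, F.exchange_over_under]
    exact (F.over_bijective _ _).1.eq_iff
  rw [IsQMul, h_fst, IsQMul, ← (bijective_qOver (F := F) s).1.eq_iff (a := r)]
  simp [qOver]

variable {p' q' s₀ s₂ : X × G}

lemma exists_slide_over : (∃ r', F.IsQMul p' q' r' ∧ F.Crossed r r' s₀ s₂) ↔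
    ∃ p q s₁, F.IsQMul p q r ∧ F.Crossed p p' s₀ s₁ ∧ F.Crossed q q' s₁ s₂ := by
  constructor
  · rintro ⟨_, h, rfl, rfl⟩
    obtain ⟨p, s₁, rfl, rfl⟩ := Crossed.exists₁₀ (F := F) p' s₀
    obtain ⟨q, _, rfl, rfl⟩ := Crossed.exists₁₀ (F := F) q' (F.qOver s₀ p)
    have hm : F.IsQMul p q r := isQMul_qUnder_iff.1 h
    exact ⟨p, q, _, hm, ⟨rfl, rfl⟩, rfl, hm.qOver_qOver.symm⟩
  · rintro ⟨p, q, _, hm, ⟨rfl, rfl⟩, rfl, rfl⟩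
    exact ⟨_, isQMul_qUnder_iff.2 hm, rfl, hm.qOver_qOver⟩

lemma exists_slide_under : (∃ r', F.IsQMul p' q' r' ∧ F.Crossed s₀ s₂ r r') ↔
    ∃ p q s₁, F.IsQMul p q r ∧ F.Crossed s₀ s₁ p p' ∧ F.Crossed s₁ s₂ q q' := by
  constructor
  · rintro ⟨_, h, rfl, rfl⟩
    obtain ⟨s₁, p, rfl, rfl⟩ := Crossed.exists₀₁ (F := F) s₀ p'
    obtain ⟨_, q, rfl, rfl⟩ := Crossed.exists₀₁ (F := F) (F.qUnder s₀ p) q'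
    have hm : F.IsQMul p q r := isQMul_qOver_iff.1 h
    exact ⟨p, q, _, hm, ⟨rfl, rfl⟩, hm.qUnder_qUnder.symm, rfl⟩
  · rintro ⟨p, q, _, hm, ⟨rfl, rfl⟩, rfl, rfl⟩
    exact ⟨_, isQMul_qOver_iff.2 hm, hm.qUnder_qUnder, rfl⟩

lemma exists_isTriangle_slide_over : (∃ r', F.IsTriangle r' p' q' ∧ F.Crossed r r' s₂ s₀) ↔
    ∃ p q s₁, F.IsTriangle r p q ∧ F.Crossed q q' s₁ s₂ ∧ F.Crossed p p' s₀ s₁ := by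
  have h := exists_slide_over (F := F) (p' := p') (q' := q') (r := F.qInv r) (s₀ := s₀) (s₂ := s₂)
  rw [(surjective_qInv (F := F)).exists] at h
  simpa only [isTriangle_iff_isQMul, crossed_qInv_under, and_comm] using h

lemma exists_isTriangle_slide_under : (∃ r', F.IsTriangle r' p' q' ∧ F.Crossed s₂ s₀ r r') ↔
    ∃ p q s₁, F.IsTriangle r p q ∧ F.Crossed s₁ s₂ q q' ∧ F.Crossed s₀ s₁ p p' := by
  have h := exists_slide_under (F := F) (p' := p') (q' := q') (r := F.qInv r) (s₀ := s₀) (s₂ := s₂)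
  rw [(surjective_qInv (F := F)).exists] at h
  simpa only [isTriangle_iff_isQMul, crossed_qInv_over, and_comm] using h

end Slide

/-! ### Crossing legs of a vertex -/

-- Both products are defined only if `p = q`, since the operations by a fixed element are injective.
lemma isQMul_iff_of_crossed {p p' q q' r : X × G} (h : F.Crossed p p' q q') :
    F.IsQMul q p' r ↔ F.IsQMul p q' r := by
  obtain ⟨rfl, rfl⟩ := h
  obtain ⟨a, g⟩ := p
  obtain ⟨b, k⟩ := q
  have h_left : F.uop k a b = F.uop k b b ↔ a = b := (F.under_bijective k b).1.eq_iff
  have h_right : F.oop g b a = F.uop g a a ↔ a = b := by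
    rw [F.under_self, (F.over_bijective g a).1.eq_iff, eq_comm]
  simp only [IsQMul, qUnder, qOver, h_left, h_right]
  refine and_congr_right ?_
  rintro rfl
  simp [mul_assoc]

end BiquandleFamily

/-! ### Colourings of fragments -/

namespace Fragment

/-- The colouring condition for a fragment: strands do not change colours. -/
def IsColored {G : Type*} [Group G] {X : Type*} (F : BiquandleFamily G X) (P : Fragment)
    (k : ℕ → X × G) : Prop :=
  (∀ s ∈ P.strands, k s.1 = k s.2) ∧ ∀ n ∈ P.nodes, n.IsColored F k

/-- The pieces of `P` are those in `B`, which may be cut, and those in `I`, which have both their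
ends in `P`. -/
def HasBoundary (B I : List ℕ) (P : Fragment) : Prop :=
  (∀ a ∈ B, (a, true) ∈ P.ends ∨ (a, false) ∈ P.ends) ∧
    (∀ a ∈ I, (a, true) ∈ P.ends ∧ (a, false) ∈ P.ends) ∧ ∀ d ∈ P.ends, d.1 ∈ B ∨ d.1 ∈ I

instance (B I : List ℕ) (P : Fragment) : Decidable (P.HasBoundary B I) := by
  unfold HasBoundary; infer_instance

variable {G : Type*} [Group G] {X : Type*} (F : BiquandleFamily G X)

/-- The colours on `B` of a colouring of `P` determine those on `I`. -/
def IsDetermined (B I : List ℕ) (P : Fragment) : Prop :=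
  ∀ k k' : ℕ → X × G, P.IsColored F k → P.IsColored F k' → (∀ a ∈ B, k a = k' a) →
    ∀ a ∈ I, k a = k' a

/-- Every colouring of `P` agrees on `B` with a colouring of `P'`. -/
def Transfers (B : List ℕ) (P P' : Fragment) : Prop :=
  ∀ k : ℕ → X × G, P.IsColored F k → ∃ k', P'.IsColored F k' ∧ ∀ a ∈ B, k' a = k a

/-- Every colouring of one of the two fragments agrees on `B` with a unique colouring of the other;
`I` and `I'` are the pieces of `P` and `P'` not in `B`. -/
structure Interchangeable (B I I' : List ℕ) (P P' : Fragment) : Prop where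
  isDetermined_left : P.IsDetermined F B I
  isDetermined_right : P'.IsDetermined F B I'
  transfers : P.Transfers F B P'
  transfers_symm : P'.Transfers F B P

end Fragment

/-! ### Colourings of the pictures of the moves -/

namespace Move

open BiquandleFamily Fragment Function

variable {G : Type*} [Group G] {X : Type*} {F : BiquandleFamily G X} {k : ℕ → X × G}

@[simp] lemma isColored_crossing_true {ui uo oi oo : ℕ} :
    (Node.crossing true ui uo oi oo).IsColored F k ↔ F.Crossed (k ui) (k uo) (k oo) (k oi) :=
  Iff.rfl

@[simp] lemma isColored_crossing_false {ui uo oi oo : ℕ} :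
    (Node.crossing false ui uo oi oo).IsColored F k ↔ F.Crossed (k uo) (k ui) (k oi) (k oo) :=
  Iff.rfl

lemma isColored_vertex {d₀ d₁ d₂ : Bool} (h : IsY d₀ d₁ d₂) {x₀ x₁ x₂ : ℕ} :
    (vertex d₀ d₁ d₂ x₀ x₁ x₂).IsColored F k ↔
      F.IsTriangle (F.orient d₀ (k x₀)) (F.orient d₁ (k x₁)) (F.orient d₂ (k x₂)) := by
  have h_split (r l i : X × G) : F.IsQMul r l i ↔ F.IsTriangle r l (F.qInv i) := by
    rw [IsTriangle, qInv_qInv]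
  match d₀, d₁, d₂ with
  | true, false, false => exact isTriangle_qInv.symm
  | false, true, false => exact isTriangle_qInv.symm.trans isTriangle_rotate
  | false, false, true => exact isTriangle_qInv.symm.trans isTriangle_rotate.symm
  | false, true, true => exact (h_split _ _ _).trans isTriangle_rotate
  | true, false, true => exact (h_split _ _ _).trans isTriangle_rotate.symm
  | true, true, false => exact h_split _ _ _
  | true, true, true | false, false, false => simp [IsY] at h

lemma isColored_cross_over_beq {e d : Bool} {x y z w : ℕ} :
    (cross true (e == d) (directed e x y) (directed d z w)).IsColored F k ↔
      F.Crossed (F.orient d (k z)) (F.orient d (k w)) (F.orient e (k y)) (F.orient e (k x)) := by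
  cases d <;> cases e <;>
    simp [cross, directed, crossed_qInv_over, crossed_qInv_under]

lemma isColored_cross_under_beq {e d : Bool} {x y z w : ℕ} :
    (cross false (e == d) (directed e x y) (directed d z w)).IsColored F k ↔
      F.Crossed (F.orient e (k y)) (F.orient e (k x)) (F.orient d (k z)) (F.orient d (k w)) := by
  cases d <;> cases e <;>
    simp [cross, directed, crossed_qInv_over, crossed_qInv_under]

lemma isColored_cross_over_bne {e d : Bool} {x y z w : ℕ} :
    (cross true (e != d) (directed e x y) (directed d z w)).IsColored F k ↔
      F.Crossed (F.orient d (k w)) (F.orient d (k z)) (F.orient e (k x)) (F.orient e (k y)) := by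
  cases d <;> cases e <;>
    simp [cross, directed, crossed_qInv_over, crossed_qInv_under]

lemma isColored_cross_under_bne {e d : Bool} {x y z w : ℕ} :
    (cross false (e != d) (directed e x y) (directed d z w)).IsColored F k ↔
      F.Crossed (F.orient e (k x)) (F.orient e (k y)) (F.orient d (k w)) (F.orient d (k z)) := by
  cases d <;> cases e <;>
    simp [cross, directed, crossed_qInv_over, crossed_qInv_under]

lemma hasBoundary_r1Right (sign underFirst : Bool) :
    (r1Right sign underFirst).HasBoundary [0, 1] [2] := by
  revert sign underFirst; decide

lemma exists_isColored_r1Right (sign underFirst : Bool) :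
    (∃ x, (r1Right sign underFirst).IsColored F (update k 2 x)) ↔ k 0 = k 1 := by
  cases sign <;> cases underFirst <;>
    simp [IsColored, r1Right, Crossed.exists_kink₀, Crossed.exists_kink₁, eq_comm, -Prod.exists]

lemma interchangeable_r1 (sign underFirst : Bool) :
    Interchangeable F [0, 1] [] [2] r1Left (r1Right sign underFirst) where
  isDetermined_left := by simp [IsDetermined]
  isDetermined_right k k' h h' e := by
    cases sign <;> cases underFirst <;>
      simp only [IsColored, r1Right, if_true, Bool.false_eq_true, if_false, List.forall_mem_cons,
        List.not_mem_nil, IsEmpty.forall_iff, implies_true, and_true, true_and,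
        isColored_crossing_true, isColored_crossing_false] at h h' e ⊢ <;>
      grind [Crossed.unique₀₀, Crossed.unique₁₁]
  transfers k h := by
    obtain ⟨x, hx⟩ := (exists_isColored_r1Right sign underFirst (F := F) (k := k)).2
      (by simpa [IsColored, r1Left] using h)
    exact ⟨_, hx, by simp⟩
  transfers_symm k h := by
    have h_eq := (exists_isColored_r1Right sign underFirst (F := F) (k := k)).1
      ⟨k 2, by simpa using h⟩
    exact ⟨k, by simpa [IsColored, r1Left] using h_eq, by simp⟩

lemma hasBoundary_r2Right (sign parallel : Bool) :
    (r2Right sign parallel).HasBoundary [0, 1, 2, 3] [4, 5] := by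
  revert sign parallel; decide

lemma interchangeable_r2 (sign parallel : Bool) :
    Interchangeable F [0, 1, 2, 3] [] [4, 5] r2Left (r2Right sign parallel) where
  isDetermined_left := by simp [IsDetermined]
  isDetermined_right k k' h h' e := by
    cases sign <;> cases parallel <;>
      simp only [IsColored, r2Right, if_true, Bool.false_eq_true, if_false, Bool.not_true,
        Bool.not_false, List.forall_mem_cons, List.not_mem_nil, IsEmpty.forall_iff, implies_true,
        and_true, true_and, isColored_crossing_true, isColored_crossing_false] at h h' e ⊢ <;>
      grind [Crossed.unique₀₀, Crossed.unique₀₁, Crossed.unique₁₀, Crossed.unique₁₁]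
  transfers k h := by
    obtain ⟨h₁, h₃⟩ : k 0 = k 1 ∧ k 2 = k 3 := by simpa [IsColored, r2Left] using h
    have h_exists : ∃ y x, (r2Right sign parallel).IsColored F (update (update k 5 y) 4 x) := by
      cases sign <;> cases parallel
      · simpa [IsColored, r2Right, h₁, h₃, -Prod.exists] using Crossed.exists₀₀ (F := F) (k 3) (k 1)
      · simpa [IsColored, r2Right, h₁, h₃, -Prod.exists] using Crossed.exists₁₀ (F := F) (k 3) (k 1)
      · simpa [IsColored, r2Right, h₁, h₃, -Prod.exists] using Crossed.exists₁₁ (F := F) (k 3) (k 1)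
      · simpa [IsColored, r2Right, h₁, h₃, -Prod.exists] using Crossed.exists₀₁ (F := F) (k 3) (k 1)
    obtain ⟨y, x, h⟩ := h_exists
    exact ⟨_, h, by simp⟩
  transfers_symm k h := by
    refine ⟨k, ?_, fun _ _ => rfl⟩
    cases sign <;> cases parallel <;>
      simp only [IsColored, r2Right, r2Left, if_true, Bool.false_eq_true, if_false, Bool.not_true,
        Bool.not_false, List.forall_mem_cons, List.not_mem_nil, IsEmpty.forall_iff, implies_true,
        and_true, true_and, isColored_crossing_true, isColored_crossing_false] at h ⊢ <;>
      grind [Crossed.unique₀₀, Crossed.unique₀₁, Crossed.unique₁₀, Crossed.unique₁₁]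

/-- The colours `k` of the pieces of `r3 x y z side` after a reversal of the middle strand unless
`x`, and of the bottom strand unless `y`. -/
def r3Reorient (F : BiquandleFamily G X) (x y : Bool) (k : ℕ → X × G) : ℕ → X × G
  | 3 => F.orient x (k (bif x then 3 else 5))
  | 4 => F.orient x (k 4)
  | 5 => F.orient x (k (bif x then 5 else 3))
  | 6 => F.orient y (k (bif y then 6 else 8))
  | 7 => F.orient y (k 7)
  | 8 => F.orient y (k (bif y then 8 else 6))
  | a => k a

lemma r3Reorient_r3Reorient (x y : Bool) (k : ℕ → X × G) :
    r3Reorient F x y (r3Reorient F x y k) = k := by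
  ext1 a
  unfold r3Reorient
  cases x <;> cases y <;> split <;> simp

lemma isColored_r3Reorient (x y z side : Bool) :
    (r3 true true (z == (x == y)) (side == (x == y))).IsColored F (r3Reorient F x y k) ↔
      (r3 x y z side).IsColored F k := by
  cases x <;> cases y <;> cases z <;> cases side <;>
    simp [IsColored, r3, cross, step, r3Reorient, crossed_qInv_over, crossed_qInv_under]

lemma hasBoundary_r3 (x y z side : Bool) :
    (r3 x y z side).HasBoundary [0, 2, 3, 5, 6, 8] [1, 4, 7] := by
  revert x y z side; decide

lemma isDetermined_r3 (x y z side : Bool) :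
    (r3 x y z side).IsDetermined F [0, 2, 3, 5, 6, 8] [1, 4, 7] := by
  intro k k' h h' e
  cases x <;> cases y <;> cases z <;> cases side <;>
    simp only [IsColored, r3, cross, step, if_true, Bool.false_eq_true, if_false, Bool.not_true,
      Bool.not_false, BEq.rfl, beq_true, beq_false, List.forall_mem_cons, List.not_mem_nil,
      IsEmpty.forall_iff, implies_true, and_true, true_and, isColored_crossing_true,
      isColored_crossing_false] at h h' e ⊢ <;>
    grind [Crossed.unique₀₀, Crossed.unique₀₁, Crossed.unique₁₀, Crossed.unique₁₁]

lemma exists_isColored_r3_true_true (z side : Bool) :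
    (∃ p q r, (r3 true true z side).IsColored F (update (update (update k 7 p) 4 q) 1 r)) ↔
      ∃ p q r, (r3 true true z !side).IsColored F (update (update (update k 7 p) 4 q) 1 r) := by
  suffices h : (∃ p q r, (r3 true true z true).IsColored F
        (update (update (update k 7 p) 4 q) 1 r)) ↔
      ∃ p q r, (r3 true true z false).IsColored F (update (update (update k 7 p) 4 q) 1 r) by
    cases side
    exacts [h.symm, h]
  cases z
  · simpa [IsColored, r3, cross, step, -Prod.exists, -exists_and_left, -exists_and_right]
      using exists_corner_100_iff_corner_011 (F := F)
  · simpa [IsColored, r3, cross, step, -Prod.exists, -exists_and_left, -exists_and_right]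
      using (exists_corner_010_iff_corner_101 (F := F)).symm

lemma transfers_r3 (x y z side : Bool) :
    (r3 x y z side).Transfers F [0, 2, 3, 5, 6, 8] (r3 x y z !side) := by
  intro k h
  have h_side : ((!side) == (x == y)) = !(side == (x == y)) := by
    cases side <;> simp
  rw [← isColored_r3Reorient] at h
  set k₀ := r3Reorient F x y k
  obtain ⟨p, q, r, h'⟩ := (exists_isColored_r3_true_true (k := k₀) _ _).1
    ⟨k₀ 7, k₀ 4, k₀ 1, by simpa only [update_eq_self] using h⟩
  refine ⟨r3Reorient F x y (update (update (update k₀ 7 p) 4 q) 1 r), ?_, ?_⟩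
  · rwa [← isColored_r3Reorient, r3Reorient_r3Reorient, h_side]
  · cases x <;> cases y <;> simp [k₀, r3Reorient]

lemma interchangeable_r3 (x y z : Bool) :
    Interchangeable F [0, 2, 3, 5, 6, 8] [1, 4, 7] [1, 4, 7] (r3 x y z true) (r3 x y z false) where
  isDetermined_left := isDetermined_r3 x y z true
  isDetermined_right := isDetermined_r3 x y z false
  transfers := transfers_r3 x y z true
  transfers_symm := transfers_r3 x y z false

section R4

variable (above east : Bool) {d₀ d₁ d₂ : Bool}

lemma hasBoundary_r4Left (h : IsY d₀ d₁ d₂) :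
    (r4Left above east d₀ d₁ d₂).HasBoundary [0, 1, 2, 3, 4] [5] := by
  revert above east d₀ d₁ d₂; unfold IsY; decide

lemma hasBoundary_r4Right (h : IsY d₀ d₁ d₂) :
    (r4Right above east d₀ d₁ d₂).HasBoundary [0, 1, 2, 3, 4] [6, 7, 8] := by
  revert above east d₀ d₁ d₂; unfold IsY; decide

lemma exists_isColored_r4 (h : IsY d₀ d₁ d₂) :
    (∃ x, (r4Left above east d₀ d₁ d₂).IsColored F (update k 5 (F.orient d₀ x))) ↔
      ∃ p q s, (r4Right above east d₀ d₁ d₂).IsColored F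
        (update (update (update k 6 (F.orient d₁ p)) 7 (F.orient d₂ q)) 8 (F.orient east s)) := by
  cases above
  · simpa [IsColored, r4Left, r4Right, isColored_vertex h, isColored_cross_under_bne,
      isColored_cross_under_beq, -Prod.exists, -exists_and_left,
      -exists_and_right] using exists_isTriangle_slide_under (F := F)
  · simpa [IsColored, r4Left, r4Right, isColored_vertex h, isColored_cross_over_bne,
      isColored_cross_over_beq, -Prod.exists, -exists_and_left,
      -exists_and_right] using exists_isTriangle_slide_over (F := F)

lemma interchangeable_r4 (h : IsY d₀ d₁ d₂) :
    Interchangeable F [0, 1, 2, 3, 4] [5] [6, 7, 8] (r4Left above east d₀ d₁ d₂)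
      (r4Right above east d₀ d₁ d₂) where
  isDetermined_left k k' hk hk' e := by
    simp only [IsColored, r4Left, isColored_vertex h, List.forall_mem_cons, List.not_mem_nil,
      IsEmpty.forall_iff, implies_true, and_true, true_and] at hk hk' e ⊢
    grind [IsTriangle.unique, IsTriangle.rotate, orient_injective]
  isDetermined_right k k' hk hk' e := by
    cases above <;>
      simp only [IsColored, r4Right, isColored_cross_over_beq, isColored_cross_under_beq,
        List.forall_mem_cons, List.not_mem_nil, IsEmpty.forall_iff, implies_true, and_true,
        true_and] at hk hk' e ⊢ <;>
      grind [Crossed.unique₀₁, Crossed.unique₁₀, orient_injective]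
  transfers k hk := by
    obtain ⟨p, q, s, h'⟩ := (exists_isColored_r4 above east h (F := F) (k := k)).1
      ⟨F.orient d₀ (k 5), by simpa using hk⟩
    exact ⟨_, h', by simp⟩
  transfers_symm k hk := by
    obtain ⟨x, h'⟩ := (exists_isColored_r4 above east h (F := F) (k := k)).2
      ⟨F.orient d₁ (k 6), F.orient d₂ (k 7), F.orient east (k 8), by simpa using hk⟩
    exact ⟨_, h', by simp⟩

end R4

section R5

variable (above : Bool) {d₀ d₁ d₂ : Bool}

lemma hasBoundary_r5Left (h : IsY d₀ d₁ d₂) : (r5Left d₀ d₁ d₂).HasBoundary [0, 1, 2] [] := by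
  revert d₀ d₁ d₂; unfold IsY; decide

lemma hasBoundary_r5Right (h : IsY d₀ d₁ d₂) :
    (r5Right above d₀ d₁ d₂).HasBoundary [0, 1, 2] [3, 4] := by
  revert above d₀ d₁ d₂; unfold IsY; decide

lemma isColored_r5Left (h : IsY d₀ d₁ d₂) : (r5Left d₀ d₁ d₂).IsColored F k ↔
    F.IsTriangle (F.orient d₀ (k 0)) (F.orient d₁ (k 1)) (F.orient d₂ (k 2)) := by
  simp [IsColored, r5Left, isColored_vertex h]

lemma isColored_r5Right (h : IsY d₀ d₁ d₂) : (r5Right above d₀ d₁ d₂).IsColored F k ↔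
    F.IsTriangle (F.orient d₀ (k 0)) (F.orient d₂ (k 3)) (F.orient d₁ (k 4)) ∧
      if above then
        F.Crossed (F.orient d₁ (k 1)) (F.orient d₁ (k 4)) (F.orient d₂ (k 3)) (F.orient d₂ (k 2))
      else
        F.Crossed (F.orient d₂ (k 3)) (F.orient d₂ (k 2)) (F.orient d₁ (k 1))
          (F.orient d₁ (k 4)) := by
  have h' : IsY d₀ d₂ d₁ := fun hd => h ⟨hd.1.trans hd.2, hd.2.symm⟩
  cases above <;>
    simp [IsColored, r5Right, isColored_vertex h', bne_comm (a := d₁), isColored_cross_over_bne,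
      isColored_cross_under_bne]

lemma isTriangle_iff_of_isColored_cross {p₀ p₁ p₂ p₃ p₄ : X × G}
    (h : if above then F.Crossed p₁ p₄ p₃ p₂ else F.Crossed p₃ p₂ p₁ p₄) :
    F.IsTriangle p₀ p₁ p₂ ↔ F.IsTriangle p₀ p₃ p₄ := by
  rw [isTriangle_iff_isQMul, isTriangle_iff_isQMul]
  cases above
  · exact isQMul_iff_of_crossed h
  · exact (isQMul_iff_of_crossed h).symm

lemma isDetermined_r5Right : (r5Right above d₀ d₁ d₂).IsDetermined F [0, 1, 2] [3, 4] := by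
  intro k k' hk hk' e
  cases above <;>
    simp only [IsColored, r5Right, bne_comm (a := d₁), isColored_cross_over_bne,
      isColored_cross_under_bne, List.forall_mem_cons, List.not_mem_nil, IsEmpty.forall_iff,
      implies_true, and_true, true_and] at hk hk' e ⊢ <;>
    grind [Crossed.unique₀₁, Crossed.unique₁₀, orient_injective]

lemma interchangeable_r5 (h : IsY d₀ d₁ d₂) : Interchangeable F [0, 1, 2] [] [3, 4]
    (r5Left d₀ d₁ d₂) (r5Right above d₀ d₁ d₂) where
  isDetermined_left := by simp [IsDetermined]
  isDetermined_right := isDetermined_r5Right above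
  transfers k hk := by
    obtain ⟨p, q, h_cross⟩ : ∃ p q, if above then
        F.Crossed (F.orient d₁ (k 1)) q p (F.orient d₂ (k 2)) else
        F.Crossed p (F.orient d₂ (k 2)) (F.orient d₁ (k 1)) q := by
      cases above
      · exact Crossed.exists₁₀ _ _
      · exact exists_comm.1 (Crossed.exists₀₁ _ _)
    refine ⟨update (update k 3 (F.orient d₂ p)) 4 (F.orient d₁ q), ?_, by simp⟩
    rw [isColored_r5Left h, isTriangle_iff_of_isColored_cross above h_cross] at hk
    simpa [isColored_r5Right above h] using ⟨hk, h_cross⟩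
  transfers_symm k hk := by
    rw [isColored_r5Right above h] at hk
    exact ⟨k, (isColored_r5Left h).2 ((isTriangle_iff_of_isColored_cross above hk.2).2 hk.1),
      fun _ _ => rfl⟩

end R5

section R6

variable {m m' d₀ d₁ d₂ d₃ : Bool}

lemma hasBoundary_r6Left (hn : IsY d₀ d₁ m) (hs : IsY d₂ d₃ (!m)) :
    (r6Left m d₀ d₁ d₂ d₃).HasBoundary [0, 1, 2, 3] [4] := by
  revert m d₀ d₁ d₂ d₃; unfold IsY; decide

lemma hasBoundary_r6Right (hw : IsY m d₁ d₂) (he : IsY d₀ (!m) d₃) :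
    (r6Right m d₀ d₁ d₂ d₃).HasBoundary [0, 1, 2, 3] [4] := by
  revert m d₀ d₁ d₂ d₃; unfold IsY; decide

lemma isColored_r6Left (hn : IsY d₀ d₁ m) (hs : IsY d₂ d₃ (!m)) :
    (r6Left m d₀ d₁ d₂ d₃).IsColored F k ↔
      F.IsTriangle (F.orient d₀ (k 0)) (F.orient d₁ (k 1)) (F.orient m (k 4)) ∧
        F.IsTriangle (F.orient d₂ (k 2)) (F.orient d₃ (k 3)) (F.qInv (F.orient m (k 4))) := by
  simp [IsColored, r6Left, isColored_vertex hn, isColored_vertex hs]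

lemma isColored_r6Right (hw : IsY m d₁ d₂) (he : IsY d₀ (!m) d₃) :
    (r6Right m d₀ d₁ d₂ d₃).IsColored F k ↔
      F.IsTriangle (F.orient d₁ (k 1)) (F.orient d₂ (k 2)) (F.orient m (k 4)) ∧
        F.IsTriangle (F.orient d₃ (k 3)) (F.orient d₀ (k 0)) (F.qInv (F.orient m (k 4))) := by
  rw [isTriangle_rotate (p := F.orient m (k 4)), ← isTriangle_rotate (p := F.orient d₃ (k 3))]
  simp [IsColored, r6Right, isColored_vertex hw, isColored_vertex he]

lemma exists_isColored_r6 (hn : IsY d₀ d₁ m) (hs : IsY d₂ d₃ (!m)) (hw : IsY m' d₁ d₂)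
    (he : IsY d₀ (!m') d₃) :
    (∃ x, (r6Left m d₀ d₁ d₂ d₃).IsColored F (update k 4 (F.orient m x))) ↔
      ∃ x, (r6Right m' d₀ d₁ d₂ d₃).IsColored F (update k 4 (F.orient m' x)) := by
  simpa [isColored_r6Left hn hs, isColored_r6Right hw he, -Prod.exists]
    using exists_isTriangle_flip (F := F)

lemma interchangeable_r6 (hn : IsY d₀ d₁ m) (hs : IsY d₂ d₃ (!m)) (hw : IsY m' d₁ d₂)
    (he : IsY d₀ (!m') d₃) :
    Interchangeable F [0, 1, 2, 3] [4] [4] (r6Left m d₀ d₁ d₂ d₃) (r6Right m' d₀ d₁ d₂ d₃) where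
  isDetermined_left k k' hk hk' e := by
    simp only [isColored_r6Left hn hs, List.forall_mem_cons, List.not_mem_nil, IsEmpty.forall_iff,
      implies_true, and_true] at hk hk' e ⊢
    grind [IsTriangle.unique, orient_injective]
  isDetermined_right k k' hk hk' e := by
    simp only [isColored_r6Right hw he, List.forall_mem_cons, List.not_mem_nil, IsEmpty.forall_iff,
      implies_true, and_true] at hk hk' e ⊢
    grind [IsTriangle.unique, orient_injective]
  transfers k hk := by
    obtain ⟨x, h⟩ := (exists_isColored_r6 hn hs hw he (F := F) (k := k)).1
      ⟨F.orient m (k 4), by simpa using hk⟩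
    exact ⟨_, h, by simp⟩
  transfers_symm k hk := by
    obtain ⟨x, h⟩ := (exists_isColored_r6 hn hs hw he (F := F) (k := k)).2
      ⟨F.orient m' (k 4), by simpa using hk⟩
    exact ⟨_, h, by simp⟩

end R6

universe u

lemma Local.exists_interchangeable {P P' : Fragment} (h : Local P P') :
    ∃ B I I', P.HasBoundary B I ∧ P'.HasBoundary B I' ∧
      ∀ (X : Type u) (F : BiquandleFamily G X), Interchangeable F B I I' P P' := by
  cases h with
  | r1 s u => exact ⟨_, _, _, by decide, hasBoundary_r1Right s u, fun _ _ => interchangeable_r1 s u⟩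
  | r2 s p => exact ⟨_, _, _, by decide, hasBoundary_r2Right s p, fun _ _ => interchangeable_r2 s p⟩
  | r3 x y z => exact ⟨_, _, _, hasBoundary_r3 x y z true, hasBoundary_r3 x y z false,
      fun _ _ => interchangeable_r3 x y z⟩
  | r4 a e _ _ _ h => exact ⟨_, _, _, hasBoundary_r4Left a e h, hasBoundary_r4Right a e h,
      fun _ _ => interchangeable_r4 a e h⟩
  | r5 a _ _ _ h => exact ⟨_, _, _, hasBoundary_r5Left h, hasBoundary_r5Right a h,
      fun _ _ => interchangeable_r5 a h⟩
  | r6 _ _ _ _ _ _ hn hs hw he => exact ⟨_, _, _, hasBoundary_r6Left hn hs,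
      hasBoundary_r6Right hw he, fun _ _ => interchangeable_r6 hn hs hw he⟩

end Move

/-! ### Colourings of glued fragments -/

namespace Node

variable {G : Type*} [Group G] {X : Type*} {F : BiquandleFamily G X} {E E' : Type*}

lemma isColored_map (f : E → E') (c : E' → X × G) (n : Node E) :
    (n.map f).IsColored F c ↔ n.IsColored F (c ∘ f) := by
  rcases n with ⟨_ | _, _, _, _, _⟩ | _ | _ <;> rfl

lemma isColored_congr {c c' : E → X × G} {n : Node E} (h : ∀ d ∈ n.ends, c d.1 = c' d.1) :
    n.IsColored F c ↔ n.IsColored F c' := by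
  rcases n with ⟨_ | _, _, _, _, _⟩ | _ | _ <;> simp_all [ends, IsColored]

lemma ends_map (f : E → E') (n : Node E) : (n.map f).ends = n.ends.map (Prod.map f id) := by
  rcases n with ⟨_ | _, _, _, _, _⟩ | _ | _ <;> rfl

end Node

namespace Fragment

variable {G : Type*} [Group G] {X : Type*} {F : BiquandleFamily G X} {P P' O : Fragment}
  {f : ℕ → ℕ} {k : ℕ → X × G} {B I : List ℕ}

lemma isColored_map : (P.map f).IsColored F k ↔ P.IsColored F (k ∘ f) := by
  simp only [IsColored, map, List.forall_mem_map, Node.isColored_map]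
  rfl

lemma isColored_append : (P.append O).IsColored F k ↔ P.IsColored F k ∧ O.IsColored F k := by
  simp only [IsColored, append, List.forall_mem_append]
  tauto

lemma mem_ends {d : ℕ × Bool} : d ∈ P.ends ↔
    (∃ s ∈ P.strands, d = (s.1, false) ∨ d = (s.2, true)) ∨ ∃ n ∈ P.nodes, d ∈ n.ends := by
  simp [ends]

lemma ends_map : (P.map f).ends = P.ends.map (Prod.map f id) := by
  simp [ends, map, List.flatMap_map, List.map_flatMap, Node.ends_map]

lemma ends_append_perm : (P.append O).ends.Perm (P.ends ++ O.ends) := by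
  simp only [ends, append, List.flatMap_append]
  grind [List.perm_append_comm, List.perm_append_comm_assoc]

lemma labels_map_append : ((P.map f).append O).labels = f '' P.labels ∪ O.labels := by
  ext a
  constructor
  · rintro ⟨t, ht⟩
    rw [ends_append_perm.mem_iff, List.mem_append, ends_map, List.mem_map] at ht
    obtain ⟨d, hd, h⟩ | ht := ht
    · exact .inl ⟨d.1, ⟨d.2, hd⟩, congrArg Prod.fst h⟩
    · exact .inr ⟨t, ht⟩
  · rintro (⟨b, ⟨t, hb⟩, rfl⟩ | ⟨t, ht⟩)
    all_goals refine ⟨t, ends_append_perm.mem_iff.2 (List.mem_append.2 ?_)⟩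
    · exact .inl (ends_map ▸ List.mem_map_of_mem hb)
    · exact .inr ht

lemma IsColored.congr {k' : ℕ → X × G} (hk : P.IsColored F k) (h : P.labels.EqOn k k') :
    P.IsColored F k' := by
  refine ⟨fun s hs => ?_, fun n hn => ?_⟩
  · rw [← h ⟨false, mem_ends.2 (.inl ⟨s, hs, .inl rfl⟩)⟩,
      ← h ⟨true, mem_ends.2 (.inl ⟨s, hs, .inr rfl⟩)⟩]
    exact hk.1 s hs
  · exact (Node.isColored_congr fun d hd => h ⟨d.2, mem_ends.2 (.inr ⟨n, hn, hd⟩)⟩).1 (hk.2 n hn)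

lemma HasBoundary.labels_eq (hB : P.HasBoundary B I) : P.labels = {a | a ∈ B ∨ a ∈ I} := by
  ext a
  refine ⟨fun ⟨b, h⟩ => hB.2.2 _ h, ?_⟩
  rintro (h | h)
  · exact (hB.1 a h).elim (fun h => ⟨_, h⟩) fun h => ⟨_, h⟩
  · exact ⟨_, (hB.2.1 a h).1⟩

lemma HasBoundary.mem_ends_of_interior (hB : P.HasBoundary B I) {a : ℕ} (ha : a ∈ I) (b : Bool) :
    (a, b) ∈ P.ends := by
  cases b
  exacts [(hB.2.1 a ha).2, (hB.2.1 a ha).1]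

section IsClosed

variable (h : ((P.map f).append O).IsClosed)
include h

lemma IsClosed.nodup_map_append :
    (P.ends.map (Prod.map f id)).Nodup ∧ (P.ends.map (Prod.map f id)).Disjoint O.ends := by
  have h_nodup := ends_append_perm.nodup_iff.1 h.1
  rw [ends_map, List.nodup_append'] at h_nodup
  exact ⟨h_nodup.1, h_nodup.2.2⟩

lemma IsClosed.eq_of_interior (hB : P.HasBoundary B I) {a b : ℕ} (ha : a ∈ I) (hb : b ∈ P.labels)
    (hf : f a = f b) : a = b := by
  obtain ⟨t, hb⟩ := hb
  exact congrArg Prod.fst (List.inj_on_of_nodup_map h.nodup_map_append.1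
    (hB.mem_ends_of_interior ha t) hb (Prod.ext hf rfl))

lemma IsClosed.notMem_labels_of_interior (hB : P.HasBoundary B I) {a : ℕ} (ha : a ∈ I) :
    f a ∉ O.labels := fun ⟨t, ht⟩ =>
  h.nodup_map_append.2 (List.mem_map_of_mem (hB.mem_ends_of_interior ha t)) ht

end IsClosed

/-- The pieces of `(P.map f).append O` that are not in the interior of `P`, if `B` is the boundary
of `P`. -/
def outerLabels (f : ℕ → ℕ) (O : Fragment) (B : List ℕ) : Set ℕ := f '' {a | a ∈ B} ∪ O.labels

lemma HasBoundary.outerLabels_subset (hB : P.HasBoundary B I) :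
    outerLabels f O B ⊆ ((P.map f).append O).labels := by
  rw [labels_map_append, hB.labels_eq]
  exact Set.union_subset_union_left _ (Set.image_mono fun _ => .inl)

lemma IsDetermined.map_append (h : P.IsDetermined F B I) (hB : P.HasBoundary B I)
    {k k' : ℕ → X × G} (hk : ((P.map f).append O).IsColored F k)
    (hk' : ((P.map f).append O).IsColored F k') (h_eq : (outerLabels f O B).EqOn k k') :
    ((P.map f).append O).labels.EqOn k k' := by
  rw [isColored_append, isColored_map] at hk hk'
  have h_boundary : ∀ a ∈ B, k (f a) = k' (f a) := fun a ha => h_eq (.inl ⟨a, ha, rfl⟩)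
  rw [labels_map_append, hB.labels_eq]
  rintro _ (⟨a, ha | ha, rfl⟩ | ha)
  · exact h_boundary a ha
  · exact h _ _ hk.1 hk'.1 h_boundary a ha
  · exact h_eq (.inr ha)

open Classical in
lemma Transfers.map_append (h : P.Transfers F B P') (hB : P'.HasBoundary B I)
    (hc : ((P'.map f).append O).IsClosed) (hk : ((P.map f).append O).IsColored F k) :
    ∃ k', ((P'.map f).append O).IsColored F k' ∧ (outerLabels f O B).EqOn k' k := by
  rw [isColored_append, isColored_map] at hk
  obtain ⟨k₁, hk₁, h_eq⟩ := h _ hk.1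
  let k' (n : ℕ) : X × G := if h : ∃ a ∈ I, f a = n then k₁ h.choose else k n
  have h_in : P'.labels.EqOn (k' ∘ f) k₁ := by
    intro b hb
    by_cases hI : ∃ a ∈ I, f a = f b
    · have h_choose : hI.choose = b := hc.eq_of_interior hB hI.choose_spec.1 hb hI.choose_spec.2
      simp only [k', Function.comp_apply, dif_pos hI, h_choose]
    · have hbB : b ∈ B := (hB.labels_eq.subset hb).resolve_right fun hbI => hI ⟨b, hbI, rfl⟩
      simp only [k', Function.comp_apply, dif_neg hI, h_eq b hbB]
  have h_out : O.labels.EqOn k' k := by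
    intro b hb
    refine dif_neg ?_
    rintro ⟨a, ha, rfl⟩
    exact hc.notMem_labels_of_interior hB ha hb
  refine ⟨k', isColored_append.2 ⟨isColored_map.2 (hk₁.congr h_in.symm), hk.2.congr h_out.symm⟩, ?_⟩
  rintro _ (⟨a, ha, rfl⟩ | ha)
  · exact (h_in (hB.labels_eq.superset (.inl ha))).trans (h_eq a ha)
  · exact h_out ha

/-- The map `s` from pieces to semiarcs realizes the diagram `D` as the fragment `P`. -/
def Realizes (P : Fragment) (D : Diagram) (s : ℕ → D.E) : Prop :=
  (∀ e, ∃ a ∈ P.labels, s a = e) ∧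
    (∀ a ∈ P.labels, ∀ b ∈ P.labels,
      s a = s b ↔ Relation.EqvGen (fun x y => (x, y) ∈ P.strands) a b) ∧
    (P.nodes.map (Node.map s)).Perm D.nodes

lemma Represents.exists_realizes {D : Diagram} (h : P.Represents D) : ∃ s, P.Realizes D s := h.2

namespace Realizes

variable {D D' : Diagram} {s : ℕ → D.E} {s' : ℕ → D'.E}

lemma isColoring_iff (hs : P.Realizes D s) {c : D.E → X × G} :
    D.IsColoring F c ↔ P.IsColored F (c ∘ s) := by
  have h_strands : ∀ t ∈ P.strands, (c ∘ s) t.1 = (c ∘ s) t.2 := fun t ht =>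
    congrArg c ((hs.2.1 _ ⟨false, mem_ends.2 (.inl ⟨t, ht, .inl rfl⟩)⟩ _
      ⟨true, mem_ends.2 (.inl ⟨t, ht, .inr rfl⟩)⟩).2 (.rel _ _ ht))
  have h_nodes : D.IsColoring F c ↔ ∀ n ∈ P.nodes.map (Node.map s), n.IsColored F c :=
    forall_congr' fun n => by rw [hs.2.2.mem_iff]
  rw [h_nodes]
  simp only [IsColored, List.forall_mem_map, Node.isColored_map]
  exact (and_iff_right h_strands).symm

lemma exists_isColoring (hs : P.Realizes D s) (hk : P.IsColored F k) :
    ∃ c, D.IsColoring F c ∧ P.labels.EqOn (c ∘ s) k := by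
  choose t ht hst using hs.1
  have h_eqvGen {a b : ℕ} (h : Relation.EqvGen (fun x y => (x, y) ∈ P.strands) a b) :
      k a = k b := by
    induction h with
    | rel _ _ h => exact hk.1 _ h
    | refl => rfl
    | symm _ _ _ h => exact h.symm
    | trans _ _ _ _ _ h h' => exact h.trans h'
  have h_eq : P.labels.EqOn (k ∘ t ∘ s) k := fun a ha =>
    h_eqvGen ((hs.2.1 _ (ht (s a)) _ ha).1 (hst _))
  exact ⟨k ∘ t, hs.isColoring_iff.2 (hk.congr h_eq.symm), h_eq⟩

end Realizes

end Fragment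

namespace Diagram

/-- Every colouring of `D` corresponds to a unique colouring of `D'` with the same colours on the
pieces in `B`, where `s` and `s'` send a piece to the semiarc that contains it. -/
def ExtendsUniquely {G : Type*} [Group G] {X : Type*} (F : BiquandleFamily G X) {D D' : Diagram}
    (B : Set ℕ) (s : ℕ → D.E) (s' : ℕ → D'.E) : Prop :=
  ∀ c, D.IsColoring F c → ∃! c', D'.IsColoring F c' ∧ B.EqOn (c' ∘ s') (c ∘ s)

end Diagram

lemma Fragment.Realizes.extendsUniquely {G : Type*} [Group G] {X : Type*}
    {F : BiquandleFamily G X} {P P' : Fragment} {D D' : Diagram} {s : ℕ → D.E} {s' : ℕ → D'.E}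
    (hs : P.Realizes D s) (hs' : P'.Realizes D' s') {B : Set ℕ} (hB : B ⊆ P'.labels)
    (h_exists : ∀ k, P.IsColored F k → ∃ k', P'.IsColored F k' ∧ B.EqOn k' k)
    (h_unique : ∀ k k', P'.IsColored F k → P'.IsColored F k' → B.EqOn k k' →
      P'.labels.EqOn k k') : Diagram.ExtendsUniquely F B s s' := by
  intro c hc
  obtain ⟨k', hk', h_eq⟩ := h_exists _ (hs.isColoring_iff.1 hc)
  obtain ⟨c', hc', h_eq'⟩ := hs'.exists_isColoring hk'
  have h_eq_c : B.EqOn (c' ∘ s') (c ∘ s) := (h_eq'.mono hB).trans h_eq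
  refine ⟨c', ⟨hc', h_eq_c⟩, ?_⟩
  rintro c'' ⟨hc'', h_eq''⟩
  funext x
  obtain ⟨a, ha, rfl⟩ := hs'.1 x
  exact h_unique _ _ (hs'.isColoring_iff.1 hc'') (hs'.isColoring_iff.1 hc')
    (h_eq''.trans h_eq_c.symm) ha

universe u

namespace Diagram

variable {G : Type*} [Group G] {D D' : Diagram}

/-- The colourings of `D` and of `D'` by any `G`-family correspond bijectively, in such a way that
corresponding colourings agree on certain common pieces of the two diagrams. -/
def SameColorings (G : Type*) [Group G] (D D' : Diagram) : Prop :=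
  ∃ (B : Set ℕ) (s : ℕ → D.E) (s' : ℕ → D'.E), ∀ (X : Type u) (F : BiquandleFamily G X),
    ExtendsUniquely F B s s' ∧ ExtendsUniquely F B s' s

lemma Isotopic.sameColorings (h : Isotopic D D') : SameColorings.{u} G D D' := by
  obtain ⟨P, h, h'⟩ := h
  obtain ⟨s, hs⟩ := h.exists_realizes
  obtain ⟨s', hs'⟩ := h'.exists_realizes
  exact ⟨P.labels, s, s', fun X F =>
    ⟨hs.extendsUniquely hs' subset_rfl (fun k hk => ⟨k, hk, fun _ _ => rfl⟩) fun _ _ _ _ h => h,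
    hs'.extendsUniquely hs subset_rfl (fun k hk => ⟨k, hk, fun _ _ => rfl⟩) fun _ _ _ _ h => h⟩⟩

lemma ReidemeisterMove.sameColorings (h : ReidemeisterMove D D') : SameColorings.{u} G D D' := by
  obtain ⟨P, P', O, f, h_local, h, h'⟩ := h
  obtain ⟨s, hs⟩ := h.exists_realizes
  obtain ⟨s', hs'⟩ := h'.exists_realizes
  obtain ⟨B, I, I', hB, hB', h_inter⟩ := h_local.exists_interchangeable (G := G)
  exact ⟨Fragment.outerLabels f O B, s, s', fun X F =>
    ⟨hs.extendsUniquely hs' hB'.outerLabels_subset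
      (fun _ => (h_inter X F).transfers.map_append hB' h'.1)
      (fun _ _ => (h_inter X F).isDetermined_right.map_append hB'),
    hs'.extendsUniquely hs hB.outerLabels_subset
      (fun _ => (h_inter X F).transfers_symm.map_append hB h.1)
      (fun _ _ => (h_inter X F).isDetermined_left.map_append hB)⟩⟩

end Diagram

/-! ### Homomorphisms as colourings -/

/-- The unique `G`-family on a one-point set, used to treat homomorphisms to `G` as colourings. -/
def BiquandleFamily.onePoint (G : Type*) [Group G] : BiquandleFamily G PUnit.{u + 1} where
  uop _ _ _ := ⟨⟩
  oop _ _ _ := ⟨⟩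
  under_self _ _ := rfl
  under_bijective _ _ := Function.bijective_id
  over_bijective _ _ := Function.bijective_id
  sideways_bijective _ _ := Function.bijective_id
  exchange_under_under _ _ _ _ _ := rfl
  exchange_over_under _ _ _ _ _ := rfl
  exchange_over_over _ _ _ _ _ := rfl
  under_mul _ _ _ _ := rfl
  over_mul _ _ _ _ := rfl

namespace Node

open BiquandleFamily

variable {G : Type*} [Group G] {E : Type*} {n : Node E}

lemma isColored_onePoint {c : E → PUnit.{u + 1} × G} :
    n.IsColored (onePoint G) c ↔ ∀ w ∈ n.relators, FreeGroup.lift (fun e => (c e).2) w = 1 := by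
  rcases n with ⟨_ | _, _, _, _, _⟩ | _ | _ <;>
    simp [relators, IsColored, qUnder, qOver, IsQMul, onePoint, Prod.ext_iff, mul_inv_eq_one,
      and_comm, -mul_inv_rev]

lemma IsColored.onePoint {X : Type*} {F : BiquandleFamily G X} {c : E → X × G}
    (h : n.IsColored F c) : n.IsColored (onePoint.{u} G) fun e => (⟨⟩, (c e).2) := by
  rcases n with ⟨_ | _, _, _, _, _⟩ | _ | _ <;>
    simp_all [IsColored, qUnder, qOver, IsQMul, BiquandleFamily.onePoint]

end Node

lemma exists_equiv_of_existsUnique {α β : Type*} {R : α → β → Prop}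
    (h : ∀ a, ∃! b, R a b) (h' : ∀ b, ∃! a, R a b) : ∃ e : α ≃ β, ∀ a, R a (e a) := by
  choose f hf hf' using h
  choose g hg hg' using h'
  exact ⟨⟨f, g, fun a => (hg' _ _ (hf a)).symm, fun b => (hf' _ _ (hg b)).symm⟩, hf⟩

namespace Diagram

open BiquandleFamily

variable {G : Type*} [Group G] {X : Type u} {F : BiquandleFamily G X} {D D' : Diagram}
  {B : Set ℕ} {s : ℕ → D.E} {s' : ℕ → D'.E}

lemma IsColoring.onePoint {c : D.E → X × G} (h : D.IsColoring F c) :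
    D.IsColoring (onePoint.{u} G) fun e => (⟨⟩, (c e).2) :=
  fun n hn => (h n hn).onePoint

/-- The values of a homomorphism on the meridians, as a colouring by the one-point family. -/
def homColoring (ψ : D.FundamentalGroup →* G) (e : D.E) : PUnit.{u + 1} × G :=
  (⟨⟩, ψ (D.meridian e))

lemma isColoring_homColoring (ψ : D.FundamentalGroup →* G) :
    D.IsColoring (onePoint.{u} G) (homColoring ψ) := by
  refine fun n hn => Node.isColored_onePoint.2 fun w hw => ?_
  have h_lift :
      FreeGroup.lift (fun e => (homColoring.{u} ψ e).2) = ψ.comp (PresentedGroup.mk _) :=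
    FreeGroup.ext_hom _ _ fun e => FreeGroup.lift_apply_of
  have h_mk : PresentedGroup.mk {w | ∃ n ∈ D.nodes, w ∈ n.relators} w = 1 :=
    PresentedGroup.one_of_mem ⟨n, hn, hw⟩
  rw [h_lift, MonoidHom.comp_apply, h_mk, map_one]

lemma exists_homColoring_eq {c : D.E → PUnit.{u + 1} × G}
    (h : D.IsColoring (onePoint.{u} G) c) :
    ∃ ψ : D.FundamentalGroup →* G, homColoring ψ = c := by
  have h_relators : ∀ w ∈ {w | ∃ n ∈ D.nodes, w ∈ n.relators},
      FreeGroup.lift (fun e => (c e).2) w = 1 :=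
    fun w ⟨n, hn, hw⟩ => Node.isColored_onePoint.1 (h n hn) w hw
  exact ⟨PresentedGroup.toGroup h_relators,
    funext fun e => Prod.ext rfl (PresentedGroup.toGroup.of h_relators)⟩

lemma homColoring_injective :
    Function.Injective (homColoring.{u} : (D.FundamentalGroup →* G) → D.E → PUnit × G) :=
  fun _ _ h => PresentedGroup.ext fun e => congrArg Prod.snd (congrFun h e)

lemma mem_fiber_iff {ψ : D.FundamentalGroup →* G} {c : D.E → X × G} : c ∈ D.fiber F ψ ↔
    D.IsColoring F c ∧ (fun e => (⟨⟩, (c e).2)) = homColoring.{u} ψ := by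
  simp [fiber, homColoring, funext_iff]

lemma ExtendsUniquely.existsUnique_hom (h : ExtendsUniquely (onePoint.{u} G) B s s')
    (ψ : D.FundamentalGroup →* G) : ∃! ψ' : D'.FundamentalGroup →* G,
      B.EqOn (homColoring.{u} ψ' ∘ s') (homColoring ψ ∘ s) := by
  obtain ⟨c', ⟨hc', h_eq⟩, h_unique⟩ := h _ (isColoring_homColoring ψ)
  obtain ⟨ψ', rfl⟩ := exists_homColoring_eq hc'
  exact ⟨ψ', h_eq, fun ψ'' h_eq' =>
    homColoring_injective (h_unique _ ⟨isColoring_homColoring ψ'', h_eq'⟩)⟩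

lemma ExtendsUniquely.existsUnique_mem_fiber (h : ExtendsUniquely F B s s')
    (h_hom : ExtendsUniquely (onePoint.{u} G) B s s')
    {ψ : D.FundamentalGroup →* G} {ψ' : D'.FundamentalGroup →* G}
    (h_eq : B.EqOn (homColoring.{u} ψ' ∘ s') (homColoring ψ ∘ s)) (c : D.fiber F ψ) :
    ∃! c' : D'.fiber F ψ', B.EqOn (c'.1 ∘ s') (c.1 ∘ s) := by
  obtain ⟨c, hc⟩ := c
  obtain ⟨hc, hcψ⟩ := mem_fiber_iff.1 hc
  obtain ⟨c', ⟨hc', hcc'⟩, h_unique⟩ := h c hc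
  have hcψ' : (fun e => (⟨⟩, (c' e).2)) = homColoring.{u} ψ' := by
    refine (h_hom _ (isColoring_homColoring ψ)).unique ⟨hc'.onePoint, fun a ha => ?_⟩
      ⟨isColoring_homColoring ψ', h_eq⟩
    rw [← hcψ]
    exact congrArg (Prod.mk _ ∘ Prod.snd) (hcc' ha)
  exact ⟨⟨c', mem_fiber_iff.2 ⟨hc', hcψ'⟩⟩, hcc', fun c'' hcc'' =>
    Subtype.ext (h_unique _ ⟨c''.2.1, hcc''⟩)⟩

lemma SameColorings.exists_equiv (h : SameColorings.{u} G D D') (F : BiquandleFamily G X) :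
    ∃ e : (D.FundamentalGroup →* G) ≃ (D'.FundamentalGroup →* G),
      ∀ ψ, Nonempty (D.fiber F ψ ≃ D'.fiber F (e ψ)) := by
  obtain ⟨B, s, s', h⟩ := h
  obtain ⟨h_to, h_from⟩ := h X F
  obtain ⟨h_hom_to, h_hom_from⟩ := h _ (onePoint.{u} G)
  obtain ⟨e, he⟩ := exists_equiv_of_existsUnique h_hom_to.existsUnique_hom fun ψ' => by
    simpa only [Set.eqOn_comm] using h_hom_from.existsUnique_hom ψ'
  refine ⟨e, fun ψ => ?_⟩
  obtain ⟨e_fiber, -⟩ := exists_equiv_of_existsUnique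
    (h_to.existsUnique_mem_fiber h_hom_to (he ψ)) fun c' => by
      simpa only [Set.eqOn_comm] using
        h_from.existsUnique_mem_fiber h_hom_from (he ψ).symm c'
  exact ⟨e_fiber⟩

lemma enhancedPolynomial_eq_of_equiv [Finite G] [Finite X]
    (e : (D.FundamentalGroup →* G) ≃ (D'.FundamentalGroup →* G))
    (he : ∀ ψ, Nonempty (D.fiber F ψ ≃ D'.fiber F (e ψ))) :
    D.enhancedPolynomial F = D'.enhancedPolynomial F := by
  let _ := Fintype.ofFinite (D.FundamentalGroup →* G)
  let _ := Fintype.ofFinite (D'.FundamentalGroup →* G)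
  exact Fintype.sum_equiv e _ _ fun ψ =>
    congrArg (Polynomial.X ^ ·) (Nat.card_congr (he ψ).some)

end Diagram

theorem proposition6p4_general {G : Type*} [Group G] {X : Type*} (F : BiquandleFamily G X)
    {D D' : Diagram} (h : D.Related D') :
    ∃ e : (D.FundamentalGroup →* G) ≃ (D'.FundamentalGroup →* G),
      ∀ ψ, Nonempty (D.fiber F ψ ≃ D'.fiber F (e ψ)) := by
  replace h : Relation.EqvGen (fun D D' => D.Isotopic D' ∨ D.ReidemeisterMove D') D D' := h
  induction h with
  | rel D D' h =>
    exact h.elim (fun h => h.sameColorings.exists_equiv F) fun h => h.sameColorings.exists_equiv F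
  | refl D => exact ⟨.refl _, fun ψ => ⟨.refl _⟩⟩
  | symm D D' _ ih =>
    obtain ⟨e, he⟩ := ih
    refine ⟨e.symm, fun ψ => ?_⟩
    obtain ⟨e_fiber⟩ := he (e.symm ψ)
    rw [e.apply_symm_apply] at e_fiber
    exact ⟨e_fiber.symm⟩
  | trans D D' D'' _ _ ih ih' =>
    obtain ⟨e, he⟩ := ih
    obtain ⟨e', he'⟩ := ih'
    exact ⟨e.trans e', fun ψ => ⟨(he ψ).some.trans (he' (e ψ)).some⟩⟩

theorem proposition6p4 {G : Type*} [Group G] [Finite G] {X : Type*} [Finite X]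
    (F : BiquandleFamily G X) :
    (∀ D D' : Diagram, D.Related D' → D.enhancedPolynomial F = D'.enhancedPolynomial F) ∧
    ∃ Φ : HandlebodyKnot → ℤ[X],
      ∀ D : Diagram, Φ D.handlebodyKnot = D.enhancedPolynomial F := by
  have h_related (D D' : Diagram) (h : D.Related D') :
      D.enhancedPolynomial F = D'.enhancedPolynomial F :=
    let ⟨e, he⟩ := proposition6p4_general F h
    Diagram.enhancedPolynomial_eq_of_equiv e he
  exact ⟨h_related, Quotient.lift (Diagram.enhancedPolynomial F) h_related, fun _ => rfl⟩
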